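/- **Setting.** Terms are variables or constants, from countably infinite supplies. A datalog program $\Pi$ is a finite set of rules $q(\bar s)\gets p_1(\bar s_1),\dots,p_\mu(\bar s_\mu)$ in which every predicate is used with one arity and every rule is safe (each head variable occurs in the body). A predicate is IDB if it is in the head of a rule of $\Pi$ with non-empty body, and EDB otherwise; EDB predicates do not occur in rule heads. An EDB of $\Pi$ is a finite set $D$ of facts over the EDB predicates of $\Pi$, and $q(\Pi,D)$ is the relation $q$ in the least fixpoint of the immediate consequence operator of $\Pi$ starting with $D$. The program $\Pi$ is *bounded* if it is equivalent to a non-recursive finite program: there is a finite set $\Pi_b$ of safe rules, none of them with an EDB predicate of $\Pi$ in its head, with arities that agree with those of $\Pi$, and with no predicate depending directly or indirectly on itself, such that $q(\Pi,D)=q(\Pi_b,D)$ for every EDB $D$ of $\Pi$ and every IDB predicate $q$ of $\Pi$. A rule $\rho'$ *subsumes* a rule $\rho$ if some substitution maps the head of $\rho'$ to the head of $\rho$ and every body atom of $\rho'$ to a body atom of $\rho$. **Algorithm.** An adorned predicate $q_\rho$ consists of an IDB predicate $q$ and a rule $\rho$ with head predicate $q$ and only EDB atoms in the body. Start with $\Pi'=\emptyset$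 and repeat the following pass until a pass leaves $\Pi'$ unchanged. For each rule $R$ of $\Pi$, with head $q(\bar s)$, IDB body atoms $p_1(\bar s_1),\dots,p_\lambda(\bar s_\lambda)$ and EDB body atoms $\mathcal E$, and for each $(\rho_1,\dots,\rho_\lambda)$ such that for every $i$ some rule of $\Pi'$ has head predicate $(p_i)_{\rho_i}$ (the set of these tuples being determined when the loop over them is entered): rename the variables of $\rho_1,\dots,\rho_\lambda$ so that the resulting rules $\rho_i'=(p_i(\bar v_i')\gets\mathcal B_i)$ share no variables with $R$ or with each other; if the pairs $(\bar s_i,\bar v_i')$ have no simultaneous unifier, do nothing; otherwise take a most general one $\sigma$, let $$\rho=\bigl(q(\sigma(\bar s))\gets \sigma(\mathcal B_1),\dots,\sigma(\mathcal B_\lambda),\sigma(\mathcal E)\bigr),$$ $$R'=\bigl(q_\rho(\sigma(\bar s))\gets (p_1)_{\rho_1}(\sigma(\bar s_1)),\dots,(p_\lambda)_{\rho_\lambda}(\sigma(\bar s_\lambda)),\sigma(\mathcal E)\bigr)$$ (identity relaxation function), and add $R'$ to $\Pi'$ unless $h_{\mathsf{cont}}(R',\Pi')$ holds. Here $h_{\mathsf{cont}}(R',\Pi')$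 holds if (1) $q_\rho$ is not recursive in $\Pi'$ and $\Pi'$ has a predicate $q_{\rho'}$ such that $\rho'$ subsumes $\rho$, or (2) $\Pi'$ contains a rule identical to $R'$ up to variable renaming. The orders of the loops, the renamings and the most general unifiers are chosen arbitrarily. **Proposition.** For every datalog program $\Pi$, the algorithm can be run on $\Pi$, and every run of it on $\Pi$, whatever the choices, terminates if and only if $\Pi$ is bounded. Moreover, the set of bounded datalog programs is recursively enumerable. -/

import Mathlib

namespace Datalog

/-! ### Syntax.  Variables, constants and (unadorned) predicate symbols are natural numbers. -/

/-- A term is a variable (`Sum.inl`) or a constant (`Sum.inr`). -/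
abbrev Term := ℕ ⊕ ℕ

/-- An atom over predicate symbols `P`: a predicate symbol and a tuple of terms. -/
abbrev Atom (P : Type) := P × List Term

/-- A rule `head ← body`. -/
abbrev Rule (P : Type) := Atom P × List (Atom P)

/-- A (finite) program; the meaning of a program depends only on the set of its rules. -/
abbrev Program (P : Type) := List (Rule P)

/-- Ordinary datalog programs. -/
abbrev Prog := Program ℕ

variable {P : Type}

/-- The head and the body atoms of a rule. -/
def Rule.atoms (R : Rule P) : List (Atom P) := R.1 :: R.2

/-- The variable `v` occurs in the atom `a`. -/
def Atom.HasVar (a : Atom P) (v : ℕ) : Prop := (Sum.inl v : Term) ∈ a.2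

/-- The variable `v` occurs in the rule `R`. -/
def Rule.HasVar (R : Rule P) (v : ℕ) : Prop := ∃ a ∈ Rule.atoms R, Atom.HasVar a v

/-- A rule is safe if each variable of its head occurs in its body. -/
def Rule.Safe (R : Rule P) : Prop := ∀ v, Atom.HasVar R.1 v → ∃ b ∈ R.2, Atom.HasVar b v

/-- The atom `a` occurs in some rule of `Pi`. -/
def Program.HasAtom (Pi : Program P) (a : Atom P) : Prop := ∃ R ∈ Pi, a ∈ Rule.atoms R

/-- The predicate symbol `p` occurs in some rule of `Pi`. -/
def Program.HasPred (Pi : Program P) (p : P) : Prop := ∃ a, Program.HasAtom Pi a ∧ a.1 = p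

/-- Each predicate symbol is used with a single arity. -/
def Program.ArityConsistent (Pi : Program P) : Prop :=
  ∃ ar : P → ℕ, ∀ a, Program.HasAtom Pi a → a.2.length = ar a.1

/-- The IDB predicates: those in the head of a rule with a non-empty body.
All other predicates are EDB predicates. -/
def idb (Pi : Prog) : List ℕ := (Pi.filter (fun R => R.2 ≠ [])).map (fun R => R.1.1)

/-- Standard positive datalog programs: arities are respected, rules are safe,
and EDB predicates do not occur in rule heads. -/
def IsDatalog (Pi : Prog) : Prop :=
  Program.ArityConsistent Pi ∧ (∀ R ∈ Pi, Rule.Safe R) ∧ (∀ R ∈ Pi, R.1.1 ∈ idb Pi)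

/-- `p` depends directly on `q` if `q` is in the body of a rule with head predicate `p`. -/
def Program.Depends (Pi : Program P) (p q : P) : Prop :=
  ∃ R ∈ Pi, R.1.1 = p ∧ ∃ b ∈ R.2, b.1 = q

/-- A predicate is recursive in `Pi` if it depends, directly or indirectly, on itself. -/
def Program.RecursivePred (Pi : Program P) (p : P) : Prop :=
  Relation.TransGen (Program.Depends Pi) p p

/-- A program is non-recursive if none of its predicates is recursive. -/
def Program.Nonrecursive (Pi : Program P) : Prop := ∀ p, ¬ Program.RecursivePred Pi p

/-! ### Semantics -/

/-- Ground atoms; the domain is the set `ℕ` of all constants. -/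
abbrev Fact := ℕ × List ℕ

/-- The value of a term under an assignment of constants to the variables. -/
def Term.ground (θ : ℕ → ℕ) : Term → ℕ
  | Sum.inl v => θ v
  | Sum.inr c => c

/-- The ground instance of an atom under an assignment. -/
def Atom.ground (θ : ℕ → ℕ) (a : Atom ℕ) : Fact := (a.1, a.2.map (Term.ground θ))

/-- `Derives Pi D f`: the fact `f` is in the least fixpoint of the immediate consequence
operator of `Pi`, starting with the database instance `D`. -/
inductive Derives (Pi : Prog) (D : Finset Fact) : Fact → Prop
  | base (f : Fact) (hf : f ∈ D) : Derives Pi D f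
  | step (R : Rule ℕ) (hR : R ∈ Pi) (θ : ℕ → ℕ)
      (hb : ∀ b ∈ R.2, Derives Pi D (Atom.ground θ b)) : Derives Pi D (Atom.ground θ R.1)

/-- `p` is an EDB predicate occurring in `Pi`. -/
def IsEDBPred (Pi : Prog) (p : ℕ) : Prop := Program.HasPred Pi p ∧ p ∉ idb Pi

/-- `D` is a database instance over the EDB schema of `Pi`. -/
def IsEDB (Pi : Prog) (D : Finset Fact) : Prop :=
  ∀ f ∈ D, f.1 ∉ idb Pi ∧ ∃ a, Program.HasAtom Pi a ∧ a.1 = f.1 ∧ a.2.length = f.2.length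

/-- `Pi'` computes the same relation as `Pi` for each IDB predicate of `Pi`, over each EDB. -/
def Equivalent (Pi Pi' : Prog) : Prop :=
  ∀ D, IsEDB Pi D → ∀ q ∈ idb Pi, ∀ t : List ℕ, Derives Pi D (q, t) ↔ Derives Pi' D (q, t)

/-- `Pi` is bounded: it is equivalent to a non-recursive (finite, safe) program `Pi'` over the
same EDB schema, i.e. arities agree and no rule of `Pi'` defines an EDB predicate of `Pi`.
`Pi'` may use auxiliary predicates. -/
def Bounded (Pi : Prog) : Prop :=
  ∃ Pi' : Prog, Program.Nonrecursive Pi' ∧ (∀ R ∈ Pi', Rule.Safe R) ∧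
    Program.ArityConsistent (Pi ++ Pi') ∧ (∀ R ∈ Pi', ¬ IsEDBPred Pi R.1.1) ∧
    Equivalent Pi Pi'

/-! ### Substitutions, subsumption, unification -/

/-- Application of a substitution to a term. -/
def Term.subst (σ : ℕ → Term) : Term → Term
  | Sum.inl v => σ v
  | Sum.inr c => Sum.inr c

/-- Application of a substitution to an atom. -/
def Atom.subst (σ : ℕ → Term) (a : Atom P) : Atom P := (a.1, a.2.map (Term.subst σ))

/-- Application of a substitution to a rule. -/
def Rule.subst (σ : ℕ → Term) (R : Rule P) : Rule P :=
  (Atom.subst σ R.1, R.2.map (Atom.subst σ))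

/-- The substitution that renames variables by the bijection `f`. -/
def renameBy (f : Equiv.Perm ℕ) : ℕ → Term := fun v => Sum.inl (f v)

/-- `R'` is obtained from `R` by renaming variables. -/
def Rule.Variant (R R' : Rule P) : Prop := ∃ f : Equiv.Perm ℕ, R' = Rule.subst (renameBy f) R

/-- `R₁` subsumes `R₀`: some homomorphism from `R₁` to `R₀` maps the head of `R₁` to the head
of `R₀` and each body atom of `R₁` to a body atom of `R₀`. -/
def Subsumes (R₁ R₀ : Rule ℕ) : Prop :=
  ∃ h : ℕ → Term, Atom.subst h R₁.1 = R₀.1 ∧ ∀ b ∈ R₁.2, Atom.subst h b ∈ R₀.2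

/-- `σ` is a simultaneous unifier of the given pairs of tuples. -/
def IsUnifier (σ : ℕ → Term) (E : List (List Term × List Term)) : Prop :=
  ∀ e ∈ E, e.1.map (Term.subst σ) = e.2.map (Term.subst σ)

/-- `σ` is a most general unifier: each unifier is obtained from it by further instantiation. -/
def IsMGU (σ : ℕ → Term) (E : List (List Term × List Term)) : Prop :=
  IsUnifier σ E ∧ ∀ τ, IsUnifier τ E → ∃ θ : ℕ → Term, ∀ v, τ v = Term.subst θ (σ v)

/-! ### Adorned programs -/

/-- Predicates of adorned programs: an EDB predicate `Sum.inl e`, or `Sum.inr ρ`, which stands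
for `q_ρ`, the IDB predicate `q` adorned by the rule `ρ`, where `q` is the head predicate
of `ρ`. -/
abbrev APred := ℕ ⊕ Rule ℕ

/-- Adorned rules. -/
abbrev ARule := Rule APred

/-- Adorned programs. -/
abbrev AProg := Program APred

/-- Equality of predicates of adorned programs up to variable renaming in the adornments. -/
def APred.Variant : APred → APred → Prop
  | Sum.inl e, Sum.inl e' => e = e'
  | Sum.inr ρ, Sum.inr ρ' => Rule.Variant ρ ρ'
  | _, _ => False

/-- The adorned rules `R` and `R'` are identical up to variable renaming. -/
def ARule.Variant (R R' : ARule) : Prop :=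
  ∃ f : Equiv.Perm ℕ, List.Forall₂
    (fun a a' => APred.Variant a.1 a'.1 ∧ a'.2 = a.2.map (Term.subst (renameBy f)))
    (Rule.atoms R) (Rule.atoms R')

/-- The containment-based membership checking function, for the rule `R` with head predicate
`q_ρ` and the program `A`: either `q_ρ` is not recursive in `A` and `A` has a predicate `q_ρ'`
such that `ρ'` subsumes `ρ`, or `A` contains `R` up to variable renaming. -/
def hCont (R : ARule) (A : AProg) : Prop :=
  (∃ ρ, R.1.1 = Sum.inr ρ ∧ ¬ Program.RecursivePred A (Sum.inr ρ) ∧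
    ∃ ρ' : Rule ℕ, Program.HasPred A (Sum.inr ρ') ∧ ρ'.1.1 = ρ.1.1 ∧ Subsumes ρ' ρ) ∨
  ∃ R' ∈ A, ARule.Variant R R'

/-! ### The algorithm.  It makes free choices (orders of the loops, names of fresh variables,
most general unifiers), so that its steps are relations between states.  A state is the
adorned program constructed so far. -/

/-- The IDB atoms in the body of `R`, a rule of `Pi`. -/
def idbAtoms (Pi : Prog) (R : Rule ℕ) : List (Atom ℕ) := R.2.filter (fun a => a.1 ∈ idb Pi)

/-- The EDB atoms in the body of `R`, a rule of `Pi`. -/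
def edbAtoms (Pi : Prog) (R : Rule ℕ) : List (Atom ℕ) := R.2.filter (fun a => a.1 ∉ idb Pi)

/-- Execution of a loop body for the elements of a list, one after the other. -/
inductive ExecList {α S : Type} (body : α → S → S → Prop) : List α → S → S → Prop
  | nil (s : S) : ExecList body [] s s
  | cons (x : α) (l : List α) (s s' s'' : S) (hx : body x s s') (hl : ExecList body l s' s'') :
      ExecList body (x :: l) s s''

/-- Execution of a loop body once for each element of a (finite) set, in some order. -/
def ForEach {α S : Type} (X : Set α) (body : α → S → S → Prop) (s s' : S) : Prop :=
  ∃ l : List α, l.Nodup ∧ (∀ x, x ∈ l ↔ x ∈ X) ∧ ExecList body l s s'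

/-- `ρs = (ρ_1, …, ρ_λ)` is a choice of adornments for the IDB atoms `p_1, …, p_λ` of `R`:
for each `i` there is a rule in `A` with head predicate `(p_i)_(ρ_i)`. -/
def IsChoice (Pi : Prog) (R : Rule ℕ) (A : AProg) (ρs : List (Rule ℕ)) : Prop :=
  List.Forall₂ (fun (a : Atom ℕ) (ρ : Rule ℕ) =>
    ρ.1.1 = a.1 ∧ ∃ R' ∈ A, R'.1.1 = (Sum.inr ρ : APred)) (idbAtoms Pi R) ρs

/-- The `ρs'` are variants of the `ρs` with no variables in common with `R` or each other. -/
def RenamedApart (R : Rule ℕ) (ρs ρs' : List (Rule ℕ)) : Prop :=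
  List.Forall₂ Rule.Variant ρs ρs' ∧
  (∀ ρ ∈ ρs', ∀ v, ¬ (Rule.HasVar R v ∧ Rule.HasVar ρ v)) ∧
  ρs'.Pairwise (fun ρ ρ' => ∀ v, ¬ (Rule.HasVar ρ v ∧ Rule.HasVar ρ' v))

/-- The pairs of argument tuples to be unified: IDB atoms of `R` and heads of the `ρs'`. -/
def unifPairs (Pi : Prog) (R : Rule ℕ) (ρs' : List (Rule ℕ)) : List (List Term × List Term) :=
  List.zipWith (fun a ρ => (a.2, ρ.1.2)) (idbAtoms Pi R) ρs'

/-- The adornment `ρ₀` of the head before relaxation: the instance of `R` under `σ`, with each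
IDB atom replaced by the body of the corresponding renamed adornment. -/
def inlined (Pi : Prog) (R : Rule ℕ) (ρs' : List (Rule ℕ)) (σ : ℕ → Term) : Rule ℕ :=
  (Atom.subst σ R.1,
    ρs'.flatMap (fun ρ => ρ.2.map (Atom.subst σ)) ++ (edbAtoms Pi R).map (Atom.subst σ))

/-- The adorned rule: the instance of `R` under `σ`, with the head adorned by `ρ` and the
IDB body atoms adorned by the `ρs`. -/
def adornedRule (Pi : Prog) (R : Rule ℕ) (ρs : List (Rule ℕ)) (σ : ℕ → Term) (ρ : Rule ℕ) :
    ARule :=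
  ((Sum.inr ρ, R.1.2.map (Term.subst σ)),
    List.zipWith (fun a ρi => ((Sum.inr ρi : APred), a.2.map (Term.subst σ)))
      (idbAtoms Pi R) ρs ++
    (edbAtoms Pi R).map (fun a => ((Sum.inl a.1 : APred), a.2.map (Term.subst σ))))

/-- The body of the inner loop, for the rule `R` and the choice `ρs`. -/
def innerBody (g : Rule ℕ → Rule ℕ) (h : ARule → AProg → Prop) (Pi : Prog) (R : Rule ℕ)
    (ρs : List (Rule ℕ)) (A A' : AProg) : Prop :=
  ∃ ρs', RenamedApart R ρs ρs' ∧
    (((¬ ∃ σ, IsUnifier σ (unifPairs Pi R ρs')) ∧ A' = A) ∨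
      ∃ σ R', IsMGU σ (unifPairs Pi R ρs') ∧
        R' = adornedRule Pi R ρs σ (g (inlined Pi R ρs' σ)) ∧
        ((h R' A ∧ A' = A) ∨ (¬ h R' A ∧ A' = A ++ [R'])))

/-- One pass through the body of the outer (repeat) loop. -/
def Pass (g : Rule ℕ → Rule ℕ) (h : ARule → AProg → Prop) (Pi : Prog) : AProg → AProg → Prop :=
  ForEach {R | R ∈ Pi} (fun R A A' =>
    ForEach {ρs | IsChoice Pi R A ρs} (innerBody g h Pi R) A A')

/-- A run with relaxation function `g` and membership checking function `h` on input `Pi`: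
`A n` is the adorned program after `n` passes, where the passes are thought of as continued
after a fixpoint. -/
def IsRun (g : Rule ℕ → Rule ℕ) (h : ARule → AProg → Prop) (Pi : Prog) (A : ℕ → AProg) : Prop :=
  A 0 = [] ∧ ∀ n, Pass g h Pi (A n) (A (n + 1))

/-- The run reaches a fixpoint: some pass does not change the adorned program. -/
def Terminates (A : ℕ → AProg) : Prop := ∃ n, A (n + 1) = A n

end Datalog

/-! An adornment is an unfolding of `Pi`: a safe rule with IDB head and EDB body that follows from
`Pi`. Everything rests on comparing what the current adornments derive in a single step (`Covers`)
with what `Pi` derives.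

Termination gives boundedness. A valuation satisfying the body of a rule of `Pi`, with each IDB atom
covered by an adornment, is a ground unifier; it factors through the most general unifier and
therefore satisfies the inlined rule (`innerBody.covers`). A candidate is dropped only if an
adornment already present subsumes it, so nothing is lost. After a pass without change the covered
facts are thus closed under the rules of `Pi`, and the adornments form an equivalent program whose
bodies are purely EDB, hence a non-recursive one (`bounded_of_closed`).

Boundedness gives termination. A fact derived by a non-recursive program depends on a bounded number
of database facts (`exists_support_bound`). Derivations commute with renaming the constants that do
not occur in the program, so only finitely many pairs of a database and a fact matter, and one stage
covers them all (`IsRun.exists_stage`). A later candidate, with its variables frozen to new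
constants, has its head covered from its body by that stage, so an adornment present subsumes it. If
its head predicate is new, it is not recursive, and clause (1) of `hCont` rejects the rule. From
then on the adornments are fixed; up to renaming there are finitely many rules over them, and clause
(2) prevents repetitions, whereas an endless run would lengthen the program in each pass.

For enumerability, a certificate lists unfoldings with explicit derivations, together with a
numerical bound. That the unfoldings are closed needs checking only on databases of bounded size
(`SmallClosed.closed`), so the check is primitive recursive. Certificates exist for exactly the
bounded programs, because the final adornments of a run supply one; the algorithm itself need not be
shown computable. -/

namespace Datalog

/-! ### Substitution, grounding and variants -/

section Substitution

variable {P : Type}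

theorem Term.ground_subst (θ : ℕ → ℕ) (σ : ℕ → Term) (t : Term) :
    Term.ground θ (Term.subst σ t) = Term.ground (fun v => Term.ground θ (σ v)) t := by
  cases t <;> rfl

theorem Atom.ground_subst (θ : ℕ → ℕ) (σ : ℕ → Term) (a : Atom ℕ) :
    Atom.ground θ (Atom.subst σ a) = Atom.ground (fun v => Term.ground θ (σ v)) a := by
  simp [Atom.ground, Atom.subst, Term.ground_subst, Function.comp_def]

theorem Term.subst_subst (τ σ : ℕ → Term) (t : Term) :
    Term.subst τ (Term.subst σ t) = Term.subst (fun v => Term.subst τ (σ v)) t := by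
  cases t <;> rfl

theorem Atom.subst_subst (τ σ : ℕ → Term) (a : Atom P) :
    Atom.subst τ (Atom.subst σ a) = Atom.subst (fun v => Term.subst τ (σ v)) a := by
  simp [Atom.subst, Term.subst_subst, Function.comp_def]

theorem Rule.subst_subst (τ σ : ℕ → Term) (R : Rule P) :
    Rule.subst τ (Rule.subst σ R) = Rule.subst (fun v => Term.subst τ (σ v)) R := by
  simp [Rule.subst, Atom.subst_subst, Function.comp_def]

theorem Term.subst_inl (t : Term) : Term.subst Sum.inl t = t := by cases t <;> rfl

theorem Atom.subst_inl (a : Atom P) : Atom.subst Sum.inl a = a := by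
  have : Term.subst Sum.inl = id := funext Term.subst_inl
  simp [Atom.subst, this]

theorem Rule.subst_inl (R : Rule P) : Rule.subst Sum.inl R = R := by
  have : (Atom.subst Sum.inl : Atom P → Atom P) = id := funext Atom.subst_inl
  simp [Rule.subst, this]

theorem Rule.atoms_subst (σ : ℕ → Term) (R : Rule P) :
    Rule.atoms (Rule.subst σ R) = (Rule.atoms R).map (Atom.subst σ) := rfl

theorem Atom.ground_congr {θ θ' : ℕ → ℕ} {a : Atom ℕ} (h : ∀ v, Atom.HasVar a v → θ v = θ' v) :
    Atom.ground θ a = Atom.ground θ' a := by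
  refine Prod.ext rfl (List.map_congr_left fun t ht => ?_)
  cases t with
  | inl v => exact h v ht
  | inr c => rfl

theorem Rule.subst_renameBy_symm (f : Equiv.Perm ℕ) (R : Rule P) :
    Rule.subst (renameBy f.symm) (Rule.subst (renameBy f) R) = R := by
  rw [Rule.subst_subst]
  convert Rule.subst_inl R using 2
  funext v
  simp [renameBy, Term.subst]

theorem Rule.Variant.symm {R R' : Rule P} (h : Rule.Variant R R') : Rule.Variant R' R := by
  obtain ⟨f, rfl⟩ := h
  exact ⟨f.symm, (Rule.subst_renameBy_symm f R).symm⟩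

theorem Rule.Variant.refl (R : Rule P) : Rule.Variant R R :=
  ⟨Equiv.refl ℕ, (Rule.subst_inl R).symm⟩

theorem Rule.Variant.subsumes {R R' : Rule ℕ} (h : Rule.Variant R R') : Subsumes R R' := by
  obtain ⟨f, rfl⟩ := h
  exact ⟨renameBy f, rfl, fun b hb => List.mem_map_of_mem hb⟩

theorem Subsumes.head_pred {R₁ R₀ : Rule ℕ} (h : Subsumes R₁ R₀) : R₁.1.1 = R₀.1.1 := by
  obtain ⟨h, h1, -⟩ := h
  rw [← h1]; rfl

end Substitution

/-! ### Covering of facts by rules, in one step -/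

/-- Some rule of `S` derives the fact `f` from `D` in one step. -/
def Covers (S : List (Rule ℕ)) (D : Set Fact) (f : Fact) : Prop :=
  ∃ ρ ∈ S, ∃ θ : ℕ → ℕ, Atom.ground θ ρ.1 = f ∧ ∀ b ∈ ρ.2, Atom.ground θ b ∈ D

/-- The IDB atoms in the body of `R` are covered by `S`, the EDB atoms hold in `D`. -/
def BodyCovered (Pi : Prog) (S : List (Rule ℕ)) (D : Set Fact) (R : Rule ℕ) (θ : ℕ → ℕ) : Prop :=
  ∀ b ∈ R.2, (b.1 ∈ idb Pi → Covers S D (Atom.ground θ b)) ∧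
    (b.1 ∉ idb Pi → Atom.ground θ b ∈ D)

/-- What `S` covers is closed under the rules of `Pi`. -/
def Closed (Pi : Prog) (S : List (Rule ℕ)) : Prop :=
  ∀ (D : Set Fact), ∀ R ∈ Pi, ∀ θ : ℕ → ℕ, BodyCovered Pi S D R θ →
    Covers S D (Atom.ground θ R.1)

theorem Covers.mono {S S' : List (Rule ℕ)} {D D' : Set Fact} {f : Fact} (h : Covers S D f)
    (hS : S ⊆ S') (hD : D ⊆ D') : Covers S' D' f := by
  obtain ⟨ρ, hρ, θ, h1, h2⟩ := h
  exact ⟨ρ, hS hρ, θ, h1, fun b hb => hD (h2 b hb)⟩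

theorem Covers.of_subsumes {ρ ρ' : Rule ℕ} {S : List (Rule ℕ)} {D : Set Fact} {f : Fact}
    (h : Covers [ρ] D f) (hs : Subsumes ρ' ρ) (hρ' : ρ' ∈ S) : Covers S D f := by
  obtain ⟨_, hρ, θ, h1, h2⟩ := h
  obtain rfl := List.mem_singleton.1 hρ
  obtain ⟨σ, h3, h4⟩ := hs
  refine ⟨ρ', hρ', fun v => Term.ground θ (σ v), ?_, fun b hb => ?_⟩
  · rw [← Atom.ground_subst θ σ, h3, h1]
  · rw [← Atom.ground_subst θ σ]
    exact h2 _ (h4 b hb)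

/-! ### Derivability of atoms from atoms -/

/-- The atom `a` is derivable from the atoms `B` by instances of the rules of `Pi`. -/
inductive DerivesAtom (Pi : Prog) (B : List (Atom ℕ)) : Atom ℕ → Prop
  | base (a : Atom ℕ) (ha : a ∈ B) : DerivesAtom Pi B a
  | step (R : Rule ℕ) (hR : R ∈ Pi) (σ : ℕ → Term)
      (hb : ∀ b ∈ R.2, DerivesAtom Pi B (Atom.subst σ b)) : DerivesAtom Pi B (Atom.subst σ R.1)

theorem DerivesAtom.subst {Pi : Prog} {B : List (Atom ℕ)} {a : Atom ℕ} (τ : ℕ → Term)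
    (h : DerivesAtom Pi B a) : DerivesAtom Pi (B.map (Atom.subst τ)) (Atom.subst τ a) := by
  induction h with
  | base a ha => exact .base _ (List.mem_map_of_mem ha)
  | step R hR σ _ ih =>
    rw [Atom.subst_subst]
    refine .step R hR _ fun b hb => ?_
    rw [← Atom.subst_subst]
    exact ih b hb

theorem DerivesAtom.mono {Pi : Prog} {B B' : List (Atom ℕ)} {a : Atom ℕ}
    (h : DerivesAtom Pi B a) (hB : B ⊆ B') : DerivesAtom Pi B' a := by
  induction h with
  | base a ha => exact .base _ (hB ha)
  | step R hR σ _ ih => exact .step R hR σ ih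

theorem DerivesAtom.derives {Pi : Prog} {B : List (Atom ℕ)} {a : Atom ℕ} {D : Finset Fact}
    {θ : ℕ → ℕ} (h : DerivesAtom Pi B a) (hB : ∀ b ∈ B, Derives Pi D (Atom.ground θ b)) :
    Derives Pi D (Atom.ground θ a) := by
  induction h with
  | base a ha => exact hB a ha
  | step R hR σ _ ih =>
    rw [Atom.ground_subst]
    refine .step R hR _ fun b hb => ?_
    rw [← Atom.ground_subst]
    exact ih b hb

theorem Derives.mono {Pi : Prog} {D D' : Finset Fact} {f : Fact} (h : Derives Pi D f)
    (hD : D ⊆ D') : Derives Pi D' f := by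
  induction h with
  | base f hf => exact .base f (hD hf)
  | step R hR θ _ ih => exact .step R hR θ ih

/-! ### Unfoldings: sound rules with EDB bodies -/

/-- `ρ` is a safe rule with an IDB head and an EDB body over the schema of `Pi` which follows
from the rules of `Pi`. -/
structure Unfolding (Pi : Prog) (ρ : Rule ℕ) : Prop where
  head : ρ.1.1 ∈ idb Pi
  body : ∀ b ∈ ρ.2, b.1 ∉ idb Pi
  arity : ∀ a ∈ Rule.atoms ρ, ∃ a', Program.HasAtom Pi a' ∧ a'.1 = a.1 ∧ a'.2.length = a.2.length
  safe : Rule.Safe ρ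
  derives : DerivesAtom Pi ρ.2 ρ.1

theorem Derives.pred_mem_idb_or_mem {Pi : Prog} {D : Finset Fact} {f : Fact}
    (hPi : IsDatalog Pi) (h : Derives Pi D f) : f.1 ∈ idb Pi ∨ f ∈ D := by
  cases h with
  | base f hf => exact .inr hf
  | step R hR θ _ => exact .inl (hPi.2.2 R hR)

theorem Derives.covers_of_closed {Pi : Prog} {S : List (Rule ℕ)} {D : Finset Fact} {f : Fact}
    (hPi : IsDatalog Pi) (hS : Closed Pi S) (hD : ∀ f ∈ D, f.1 ∉ idb Pi) (h : Derives Pi D f)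
    (hf : f.1 ∈ idb Pi) : Covers S D f := by
  induction h with
  | base f hf' => exact absurd hf (hD f hf')
  | step R hR θ hb ih =>
    exact hS D R hR θ fun b hb' => ⟨fun hi => ih b hb' hi, fun hi =>
      ((hb b hb').pred_mem_idb_or_mem hPi).resolve_left hi⟩

/-- Heads are IDB and bodies EDB, so dependency chains leave the IDB predicates at once and cannot
return. -/
theorem nonrecursive_of_unfolding {Pi : Prog} {S : List (Rule ℕ)}
    (hS : ∀ ρ ∈ S, Unfolding Pi ρ) : Program.Nonrecursive S := by
  intro p hp
  have key : ∀ q, Relation.TransGen (Program.Depends S) p q → p ∈ idb Pi ∧ q ∉ idb Pi := by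
    intro q h
    induction h with
    | single h =>
      obtain ⟨R, hR, rfl, b, hb, rfl⟩ := h
      exact ⟨(hS R hR).head, (hS R hR).body b hb⟩
    | tail _ h ih =>
      obtain ⟨R, hR, rfl, b, hb, rfl⟩ := h
      exact ⟨ih.1, (hS R hR).body b hb⟩
  exact (key p hp).2 (key p hp).1

/-- The non-recursive program is `S` itself. Closedness gives completeness by induction on
derivations in `Pi`; soundness holds because each rule of `S` unfolds to a derivation in `Pi`. -/
theorem bounded_of_closed {Pi : Prog} {S : List (Rule ℕ)} (hPi : IsDatalog Pi)
    (hS : ∀ ρ ∈ S, Unfolding Pi ρ) (hc : Closed Pi S) : Bounded Pi := by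
  refine ⟨S, nonrecursive_of_unfolding hS, fun R hR => (hS R hR).safe, ?_,
    fun R hR h => h.2 (hS R hR).head, fun D hD q hq t => ⟨fun h => ?_, fun h => ?_⟩⟩
  · obtain ⟨ar, har⟩ := hPi.1
    refine ⟨ar, ?_⟩
    rintro a ⟨R, hR, ha⟩
    rcases List.mem_append.1 hR with hR | hR
    · exact har a ⟨R, hR, ha⟩
    · obtain ⟨a', h1, h2, h3⟩ := (hS R hR).arity a ha
      rw [← h3, har a' h1, h2]
  · obtain ⟨ρ, hρ, θ, h1, h2⟩ := h.covers_of_closed hPi hc (fun f hf => (hD f hf).1) hq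
    rw [← h1]
    exact .step ρ hρ θ fun b hb => .base _ (h2 b hb)
  · generalize ((q, t) : Fact) = f at h
    induction h with
    | base f hf => exact .base f hf
    | step R hR θ _ ih => exact (hS R hR).derives.derives ih

/-! ### Most general unifiers -/

-- No unification algorithm is needed. Identify two terms when every unifier does. A class contains
-- at most one constant, because the given unifier separates constants. Sending each variable to a
-- representative of its class, the constant if there is one, is a unifier, and every unifier `τ`
-- satisfies `τ = τ ∘ σ`.
open Classical in
theorem exists_isMGU {E : List (List Term × List Term)} (hE : ∃ σ, IsUnifier σ E) :
    ∃ σ, IsMGU σ E := by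
  obtain ⟨τ₀, hτ₀⟩ := hE
  let r : Setoid Term :=
    { r := fun s t => ∀ τ, IsUnifier τ E → Term.subst τ s = Term.subst τ t
      iseqv := ⟨fun _ _ _ => rfl, fun h τ hτ => (h τ hτ).symm,
        fun h h' τ hτ => (h τ hτ).trans (h' τ hτ)⟩ }
  have hr : ∀ c d : ℕ, r.r (Sum.inr c) (Sum.inr d) → c = d := fun c d h => by
    have := h τ₀ hτ₀
    simpa [Term.subst] using this
  let rep : Quotient r → Term := fun x =>
    if h : ∃ c : ℕ, x = Quotient.mk r (Sum.inr c) then Sum.inr h.choose else x.out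
  have hrep : ∀ t : Term, r.r t (rep (Quotient.mk r t)) := by
    intro t
    by_cases h : ∃ c : ℕ, Quotient.mk r t = Quotient.mk r (Sum.inr c)
    · simp only [rep, dif_pos h]
      exact Quotient.exact h.choose_spec
    · simp only [rep, dif_neg h]
      exact r.iseqv.symm (Quotient.exact (Quotient.out_eq (Quotient.mk r t)))
  let σ : ℕ → Term := fun v => rep (Quotient.mk r (Sum.inl v))
  have hσ : ∀ t : Term, Term.subst σ t = rep (Quotient.mk r t) := by
    intro t
    cases t with
    | inl v => rfl
    | inr c =>
      have h : ∃ d : ℕ, Quotient.mk r (Sum.inr c) = Quotient.mk r (Sum.inr d) := ⟨c, rfl⟩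
      have h2 : rep (Quotient.mk r (Sum.inr c)) = Sum.inr h.choose := dif_pos h
      rw [h2, ← hr c _ (Quotient.exact h.choose_spec)]
      rfl
  refine ⟨σ, fun e he => ?_, fun τ hτ => ⟨τ, fun v => ?_⟩⟩
  · have hlen : e.1.length = e.2.length := by
      simpa using congrArg List.length (hτ₀ e he)
    refine List.ext_getElem (by simpa using hlen) fun i h1 h2 => ?_
    simp only [List.getElem_map, hσ]
    refine congrArg rep (Quotient.sound ?_)
    intro τ hτ
    have h3 := congrArg (fun l => l[i]?) (hτ e he)
    simp only [List.length_map] at h1 h2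
    simpa [h1, h2] using h3
  · exact hrep (Sum.inl v) τ hτ

/-- A most general unifier invents no constants: one that is absent from the equations could be
replaced by a variable, giving a unifier that is no instance of `σ`. This keeps all constants of a
run below a fixed bound. -/
theorem IsMGU.const_mem {σ : ℕ → Term} {E : List (List Term × List Term)} (hσ : IsMGU σ E)
    {v c : ℕ} (hv : σ v = Sum.inr c) :
    ∃ e ∈ E, (Sum.inr c : Term) ∈ e.1 ∨ (Sum.inr c : Term) ∈ e.2 := by
  by_contra! hc
  let g : Term → Term := fun t => if t = Sum.inr c then Sum.inl 0 else t
  have hg : ∀ t : Term, t ≠ Sum.inr c →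
      Term.subst (fun v => g (σ v)) t = g (Term.subst σ t) := by
    intro t ht
    cases t with
    | inl v => rfl
    | inr d => simp [Term.subst, g, ht]
  have hu : IsUnifier (fun v => g (σ v)) E := by
    intro e he
    have h1 : ∀ l : List Term, (Sum.inr c : Term) ∉ l →
        l.map (Term.subst fun v => g (σ v)) = (l.map (Term.subst σ)).map g := by
      intro l hl
      rw [List.map_map]
      exact List.map_congr_left fun t ht => hg t fun h => hl (h ▸ ht)
    rw [h1 _ (hc e he).1, h1 _ (hc e he).2, hσ.1 e he]
  obtain ⟨θ, hθ⟩ := hσ.2 _ hu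
  have := hθ v
  simp [hv, g, Term.subst] at this

/-! ### Renaming apart -/

theorem exists_perm_ge (M B : ℕ) : ∃ f : Equiv.Perm ℕ, ∀ v < M, B ≤ f v := by
  let T := max M B
  have hT : M ≤ T ∧ B ≤ T := ⟨le_max_left _ _, le_max_right _ _⟩
  -- Reflection of the interval `[0, 2T)`, which sends its lower half to its upper half.
  let g : ℕ → ℕ := fun v => if v < 2 * T then 2 * T - 1 - v else v
  have hg : Function.Involutive g := by
    intro v
    simp only [g]
    split_ifs <;> omega
  refine ⟨hg.toPerm, fun v hv => ?_⟩
  change B ≤ g v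
  simp only [g]
  split_ifs <;> omega

theorem Atom.exists_var_bound {P : Type} (a : Atom P) : ∃ M, ∀ v, Atom.HasVar a v → v < M := by
  have h : {v | Atom.HasVar a v}.Finite :=
    Set.Finite.preimage (Sum.inl_injective.injOn) a.2.finite_toSet
  obtain ⟨M, hM⟩ := h.bddAbove
  exact ⟨M + 1, fun v hv => Nat.lt_succ_of_le (hM hv)⟩

theorem exists_uniform_bound {α : Type*} (l : List α) (p : α → ℕ → Prop)
    (h : ∀ x ∈ l, ∃ n, p x n) (hp : ∀ x m n, m ≤ n → p x m → p x n) :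
    ∃ n, ∀ x ∈ l, p x n := by
  induction l with
  | nil => exact ⟨0, by simp⟩
  | cons x l ih =>
    obtain ⟨n, hn⟩ := ih fun y hy => h y (List.mem_cons_of_mem _ hy)
    obtain ⟨m, hm⟩ := h x List.mem_cons_self
    refine ⟨max m n, fun y hy => ?_⟩
    rcases List.mem_cons.1 hy with rfl | hy
    · exact hp _ _ _ (le_max_left _ _) hm
    · exact hp _ _ _ (le_max_right _ _) (hn y hy)

theorem Rule.exists_var_bound {P : Type} (R : Rule P) : ∃ M, ∀ v, Rule.HasVar R v → v < M := by
  obtain ⟨M, hM⟩ := exists_uniform_bound (Rule.atoms R) (fun a M => ∀ v, Atom.HasVar a v → v < M)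
    (fun a _ => Atom.exists_var_bound a) (fun a m n hmn h v hv => (h v hv).trans_le hmn)
  exact ⟨M, fun v ⟨a, ha, hv⟩ => hM a ha v hv⟩

theorem Atom.hasVar_renameBy {P : Type} {f : Equiv.Perm ℕ} {a : Atom P} {v : ℕ} :
    Atom.HasVar (Atom.subst (renameBy f) a) v ↔ Atom.HasVar a (f.symm v) := by
  simp only [Atom.HasVar, Atom.subst, List.mem_map]
  constructor
  · rintro ⟨t, ht, h⟩
    cases t with
    | inl w =>
      simp only [Term.subst, renameBy, Sum.inl.injEq] at h
      rw [← h]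
      simpa using ht
    | inr c => simp [Term.subst] at h
  · intro h
    exact ⟨_, h, by simp [Term.subst, renameBy]⟩

theorem Rule.hasVar_renameBy {P : Type} {f : Equiv.Perm ℕ} {R : Rule P} {v : ℕ} :
    Rule.HasVar (Rule.subst (renameBy f) R) v ↔ Rule.HasVar R (f.symm v) := by
  simp only [Rule.HasVar, Rule.atoms_subst, List.mem_map, exists_exists_and_eq_and,
    Atom.hasVar_renameBy]

theorem exists_renamedApart (R : Rule ℕ) (ρs : List (Rule ℕ)) :
    ∃ ρs', RenamedApart R ρs ρs' := by
  obtain ⟨B, hB⟩ := Rule.exists_var_bound R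
  suffices h : ∀ B, ∃ ρs', List.Forall₂ Rule.Variant ρs ρs' ∧
      (∀ ρ ∈ ρs', ∀ v, Rule.HasVar ρ v → B ≤ v) ∧
      ρs'.Pairwise (fun ρ ρ' => ∀ v, ¬ (Rule.HasVar ρ v ∧ Rule.HasVar ρ' v)) by
    obtain ⟨ρs', h1, h2, h3⟩ := h B
    exact ⟨ρs', h1, fun ρ hρ v hv => absurd (hB v hv.1) (not_lt.2 (h2 ρ hρ v hv.2)), h3⟩
  clear hB
  induction ρs with
  | nil => exact fun _ => ⟨[], .nil, by simp, .nil⟩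
  | cons ρ ρs ih =>
    intro B
    obtain ⟨M, hM⟩ := Rule.exists_var_bound ρ
    obtain ⟨f, hf⟩ := exists_perm_ge M B
    obtain ⟨M', hM'⟩ := Rule.exists_var_bound (Rule.subst (renameBy f) ρ)
    obtain ⟨ρs', h1, h2, h3⟩ := ih (max B M')
    refine ⟨_ :: ρs', .cons ⟨f, rfl⟩ h1, fun ρ' hρ' v hv => ?_, .cons (fun ρ' hρ' v hv => ?_) h3⟩
    · rcases List.mem_cons.1 hρ' with rfl | hρ'
      · have := hf _ (hM _ (Rule.hasVar_renameBy.1 hv))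
        simpa using this
      · exact (le_max_left _ _).trans (h2 _ hρ' v hv)
    · exact absurd (hM' v hv.1) (not_lt.2 ((le_max_right _ _).trans (h2 _ hρ' v hv.2)))

/-! ### Execution of loops -/

section Loops

variable {α S : Type} {body : α → S → S → Prop}

theorem ExecList.invariant {l : List α} {s s' : S} (h : ExecList body l s s') (I : S → Prop)
    (hI : ∀ x ∈ l, ∀ s s', body x s s' → I s → I s') (hs : I s) : I s' := by
  induction h with
  | nil s => exact hs
  | cons x l s s' s'' hx _ ih =>
    exact ih (fun y hy => hI y (List.mem_cons_of_mem _ hy)) (hI x List.mem_cons_self _ _ hx hs)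

theorem ExecList.split {l : List α} {s s' : S} (h : ExecList body l s s') {x : α} (hx : x ∈ l) :
    ∃ l₁ l₂ t t', l₁ ⊆ l ∧ l₂ ⊆ l ∧ ExecList body l₁ s t ∧ body x t t' ∧ ExecList body l₂ t' s' := by
  induction h with
  | nil s => simp at hx
  | cons y l s s' s'' hy hl ih =>
    rcases List.mem_cons.1 hx with rfl | hx
    · exact ⟨[], l, s, s', by simp, List.subset_cons_self _ _, .nil s, hy, hl⟩
    · obtain ⟨l₁, l₂, t, t', h1, h2, h3, h4, h5⟩ := ih hx
      exact ⟨y :: l₁, l₂, t, t', List.cons_subset_cons _ h1, List.subset_cons_of_subset _ h2,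
        .cons y l₁ s s' t hy h3, h4, h5⟩

theorem ExecList.exists_of_total (h : ∀ x s, ∃ s', body x s s') (l : List α) (s : S) :
    ∃ s', ExecList body l s s' := by
  induction l generalizing s with
  | nil => exact ⟨s, .nil s⟩
  | cons x l ih =>
    obtain ⟨s', hs'⟩ := h x s
    obtain ⟨s'', hs''⟩ := ih s'
    exact ⟨s'', .cons x l s s' s'' hs' hs''⟩

theorem ForEach.exists_of_total {X : Set α} (hX : X.Finite) (h : ∀ x s, ∃ s', body x s s')
    (s : S) : ∃ s', ForEach X body s s' := by
  obtain ⟨s', hs'⟩ := ExecList.exists_of_total h hX.toFinset.toList s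
  exact ⟨s', _, Finset.nodup_toList _, by simp, hs'⟩

end Loops

/-- The adornments of the predicates of `A`. -/
def adornments (A : AProg) : List (Rule ℕ) :=
  A.flatMap fun R => (Rule.atoms R).filterMap fun a => a.1.getRight?

theorem mem_adornments {A : AProg} {ρ : Rule ℕ} :
    ρ ∈ adornments A ↔ Program.HasPred A (Sum.inr ρ) := by
  simp only [adornments, List.mem_flatMap, List.mem_filterMap, Sum.getRight?_eq_some_iff,
    Program.HasPred, Program.HasAtom]
  grind

theorem mem_adornments_of_head {A : AProg} {ρ : Rule ℕ} {R : ARule} (hR : R ∈ A)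
    (h : R.1.1 = Sum.inr ρ) : ρ ∈ adornments A :=
  mem_adornments.2 ⟨R.1, ⟨R, hR, List.mem_cons_self⟩, h⟩

theorem adornments_mono {A A' : AProg} (h : A ⊆ A') : adornments A ⊆ adornments A' :=
  by
  intro ρ hρ
  simp only [adornments, List.mem_flatMap] at hρ ⊢
  obtain ⟨R, hR, h'⟩ := hρ
  exact ⟨R, h hR, h'⟩

theorem adornments_append {A A' : AProg} :
    adornments (A ++ A') = adornments A ++ adornments A' := by
  simp [adornments]

/-! ### Choices of adornments and their unification problems -/

section Choice

variable {Pi : Prog} {R : Rule ℕ}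

theorem mem_idbAtoms {b : Atom ℕ} : b ∈ idbAtoms Pi R ↔ b ∈ R.2 ∧ b.1 ∈ idb Pi := by
  simp [idbAtoms]

theorem mem_edbAtoms {b : Atom ℕ} : b ∈ edbAtoms Pi R ↔ b ∈ R.2 ∧ b.1 ∉ idb Pi := by
  simp [edbAtoms]

theorem IsChoice.mono {A A' : AProg} {ρs : List (Rule ℕ)} (h : IsChoice Pi R A ρs)
    (hA : A ⊆ A') : IsChoice Pi R A' ρs :=
  List.Forall₂.imp (fun _ _ ⟨h1, R', h2, h3⟩ => ⟨h1, R', hA h2, h3⟩) h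

theorem IsChoice.subset_adornments {A : AProg} {ρs : List (Rule ℕ)} (h : IsChoice Pi R A ρs) :
    ρs ⊆ adornments A := by
  intro ρ hρ
  unfold IsChoice at h
  generalize idbAtoms Pi R = bs at h
  induction h with
  | nil => simp at hρ
  | cons h _ ih =>
    rcases List.mem_cons.1 hρ with rfl | hρ
    · obtain ⟨-, R', h2, h3⟩ := h
      exact mem_adornments_of_head h2 h3
    · exact ih hρ

theorem finite_isChoice (A : AProg) : {ρs | IsChoice Pi R A ρs}.Finite := by
  refine (List.finite_toSet
    (List.sections ((idbAtoms Pi R).map fun _ => adornments A))).subset fun ρs h => ?_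
  refine List.mem_sections.2 ?_
  rw [List.forall₂_map_right_iff]
  refine List.Forall₂.flip (List.Forall₂.imp (fun a ρ h => ?_) h)
  obtain ⟨-, R', h2, h3⟩ := h
  exact mem_adornments_of_head h2 h3

/-- Equality of lengths matters because `List.zipWith` truncates. -/
theorem isUnifier_unifPairs {σ : ℕ → Term} {ρs : List (Rule ℕ)}
    (hl : (idbAtoms Pi R).length = ρs.length) : IsUnifier σ (unifPairs Pi R ρs) ↔
      List.Forall₂ (fun b ρ => b.2.map (Term.subst σ) = ρ.1.2.map (Term.subst σ))
        (idbAtoms Pi R) ρs := by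
  unfold unifPairs IsUnifier
  generalize idbAtoms Pi R = bs at hl
  induction bs generalizing ρs with
  | nil => cases ρs <;> simp_all
  | cons b bs ih =>
    cases ρs with
    | nil => simp at hl
    | cons ρ ρs => simp [← ih (Nat.succ_injective hl)]

end Choice

/-! ### Loops of the algorithm -/

section Pass

variable {g : Rule ℕ → Rule ℕ} {hc : ARule → AProg → Prop} {Pi : Prog}

theorem innerBody.prefix {R : Rule ℕ} {ρs : List (Rule ℕ)} {A A' : AProg}
    (h : innerBody g hc Pi R ρs A A') : A <+: A' := by
  obtain ⟨_, _, ⟨-, rfl⟩ | ⟨_, R', -, -, ⟨-, rfl⟩ | ⟨-, rfl⟩⟩⟩ := h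
  · exact List.prefix_rfl
  · exact List.prefix_rfl
  · exact List.prefix_append _ _

theorem ForEach.prefix {R : Rule ℕ} {X : Set (List (Rule ℕ))} {A A' : AProg}
    (h : ForEach X (innerBody g hc Pi R) A A') : A <+: A' := by
  obtain ⟨l, -, -, h⟩ := h
  exact h.invariant (fun B => A <+: B) (fun _ _ _ _ hb hB => hB.trans hb.prefix) List.prefix_rfl

theorem Pass.invariant {A A' : AProg} (h : Pass g hc Pi A A') (I : AProg → Prop)
    (hI : ∀ R ∈ Pi, ∀ ρs B B', IsChoice Pi R B ρs → innerBody g hc Pi R ρs B B' → I B → I B')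
    (hA : I A) : I A' := by
  obtain ⟨l, -, hl, h⟩ := h
  refine h.invariant I (fun R hR B B' hb hB => ?_) hA
  obtain ⟨l', -, hl', hb⟩ := hb
  refine (hb.invariant (fun C => B <+: C ∧ I C) (fun ρs hρs C C' hc hC => ?_)
    ⟨List.prefix_rfl, hB⟩).2
  exact ⟨hC.1.trans hc.prefix,
    hI R ((hl R).1 hR) ρs C C' (((hl' ρs).1 hρs).mono hC.1.subset) hc hC.2⟩

/-- The tuples for `R` are fixed only when its loop is entered, but the program only grows during a
pass, so a choice available at the start of the pass is still processed. -/
theorem Pass.exists_innerBody {A A' : AProg} (h : Pass g hc Pi A A') {R : Rule ℕ} (hR : R ∈ Pi)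
    {ρs : List (Rule ℕ)} (hρs : IsChoice Pi R A ρs) :
    ∃ B B', A <+: B ∧ innerBody g hc Pi R ρs B B' ∧ B' <+: A' := by
  obtain ⟨l, -, hl, h⟩ := h
  obtain ⟨l₁, l₂, B, B', -, -, h1, h2, h3⟩ := h.split ((hl R).2 hR)
  have h1' := h1.invariant (fun B => A <+: B)
    (fun _ _ _ _ hb hB => hB.trans (ForEach.prefix hb)) List.prefix_rfl
  have h3' := h3.invariant (fun B => B' <+: B)
    (fun _ _ _ _ hb hB => hB.trans (ForEach.prefix hb)) List.prefix_rfl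
  obtain ⟨m, -, hm, h2⟩ := h2
  obtain ⟨m₁, m₂, C, C', -, -, h4, h5, h6⟩ := h2.split ((hm ρs).2 (hρs.mono h1'.subset))
  have h4' := h4.invariant (fun C => B <+: C) (fun _ _ _ _ hb hB => hB.trans hb.prefix)
    List.prefix_rfl
  have h6' := h6.invariant (fun C => C' <+: C) (fun _ _ _ _ hb hB => hB.trans hb.prefix)
    List.prefix_rfl
  exact ⟨C, C', h1'.trans h4', h5, h6'.trans h3'⟩

theorem innerBody_total (R : Rule ℕ) (ρs : List (Rule ℕ)) (A : AProg) :
    ∃ A', innerBody g hc Pi R ρs A A' := by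
  obtain ⟨ρs', h⟩ := exists_renamedApart R ρs
  by_cases hu : ∃ σ, IsUnifier σ (unifPairs Pi R ρs')
  · obtain ⟨σ, hσ⟩ := exists_isMGU hu
    by_cases hh : hc (adornedRule Pi R ρs σ (g (inlined Pi R ρs' σ))) A
    · exact ⟨A, ρs', h, .inr ⟨σ, _, hσ, rfl, .inl ⟨hh, rfl⟩⟩⟩
    · exact ⟨_, ρs', h, .inr ⟨σ, _, hσ, rfl, .inr ⟨hh, rfl⟩⟩⟩
  · exact ⟨A, ρs', h, .inl ⟨hu, rfl⟩⟩

theorem Pass.total (A : AProg) : ∃ A', Pass g hc Pi A A' :=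
  ForEach.exists_of_total (List.finite_toSet Pi)
    (fun R A => ForEach.exists_of_total (finite_isChoice A) (fun ρs A => innerBody_total R ρs A) A)
    A

variable (g hc Pi) in
theorem exists_isRun : ∃ A, IsRun g hc Pi A := by
  choose F hF using fun A => Pass.total (g := g) (hc := hc) (Pi := Pi) A
  exact ⟨fun n => F^[n] [], rfl, fun n => by
    have : F^[n + 1] [] = F (F^[n] []) := Function.iterate_succ_apply' F n []
    simp only [this]
    exact hF _⟩

theorem IsRun.invariant {A : ℕ → AProg} (h : IsRun g hc Pi A) (I : AProg → Prop)
    (hI : ∀ R ∈ Pi, ∀ ρs B B', IsChoice Pi R B ρs → innerBody g hc Pi R ρs B B' → I B → I B')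
    {m : ℕ} (hm : I (A m)) {n : ℕ} (hn : m ≤ n) : I (A n) := by
  induction n, hn using Nat.le_induction with
  | base => exact hm
  | succ n _ ih => exact (h.2 n).invariant I hI ih

theorem IsRun.prefix {A : ℕ → AProg} (h : IsRun g hc Pi A) {m n : ℕ} (hn : m ≤ n) :
    A m <+: A n :=
  h.invariant (fun B => A m <+: B) (fun _ _ _ _ _ _ hb hB => hB.trans hb.prefix)
    List.prefix_rfl hn

end Pass

/-! ### One pass covers what follows by one application of a rule -/

/-- Valuations of rules with pairwise disjoint variables glue to a single one; this is what renaming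
apart is for. -/
theorem exists_common_valuation {Q : Atom ℕ → Rule ℕ → (ℕ → ℕ) → Prop} {R : Rule ℕ}
    {θ : ℕ → ℕ}
    (hQ : ∀ b ρ η η', (∀ v, Rule.HasVar ρ v → η v = η' v) → Q b ρ η → Q b ρ η')
    {bs : List (Atom ℕ)} {ρs : List (Rule ℕ)}
    (h : List.Forall₂ (fun b ρ => ∃ η, Q b ρ η) bs ρs)
    (hR : ∀ ρ ∈ ρs, ∀ v, ¬ (Rule.HasVar R v ∧ Rule.HasVar ρ v))
    (hρ : ρs.Pairwise (fun ρ ρ' => ∀ v, ¬ (Rule.HasVar ρ v ∧ Rule.HasVar ρ' v))) :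
    ∃ η, (∀ v, Rule.HasVar R v → η v = θ v) ∧ List.Forall₂ (fun b ρ => Q b ρ η) bs ρs := by
  classical
  induction h with
  | nil => exact ⟨θ, fun _ _ => rfl, .nil⟩
  | @cons b ρ bs ρs hb h ih =>
    obtain ⟨η, hη⟩ := hb
    rw [List.pairwise_cons] at hρ
    obtain ⟨η', h1, h2⟩ := ih (fun ρ hρ => hR ρ (List.mem_cons_of_mem _ hρ)) hρ.2
    refine ⟨fun v => if Rule.HasVar ρ v then η v else η' v, fun v hv => ?_, .cons ?_ ?_⟩
    · exact (if_neg fun h => hR ρ List.mem_cons_self v ⟨hv, h⟩).trans (h1 v hv)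
    · exact hQ _ _ _ _ (fun v hv => by rw [if_pos hv]) hη
    · have h3 := List.forall₂_iff_get.1 h2
      refine List.forall₂_iff_get.2 ⟨h3.1, fun i hi hi' => ?_⟩
      refine hQ _ _ _ _ (fun v hv => ?_) (h3.2 i hi hi')
      rw [if_neg fun h => hρ.1 _ (List.get_mem _ _) v ⟨h, hv⟩]

theorem Covers.of_variant {ρ ρ' : Rule ℕ} {D : Set Fact} {f : Fact} (h : Covers [ρ] D f)
    (hv : Rule.Variant ρ ρ') : Covers [ρ'] D f :=
  h.of_subsumes hv.symm.subsumes (by simp)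

/-- The central step: whether the candidate is added or dropped, the adornments afterwards cover the
fact that `R` yields from facts covered by `ρs`. -/
theorem innerBody.covers {Pi : Prog} {R : Rule ℕ} {ρs : List (Rule ℕ)} {A A' : AProg}
    (h : innerBody id hCont Pi R ρs A A') {D : Set Fact} {θ : ℕ → ℕ}
    (hI : List.Forall₂ (fun b ρ => Covers [ρ] D (Atom.ground θ b)) (idbAtoms Pi R) ρs)
    (hE : ∀ b ∈ edbAtoms Pi R, Atom.ground θ b ∈ D) :
    Covers (adornments A') D (Atom.ground θ R.1) := by
  obtain ⟨ρs', ⟨hv, hd, hp⟩, h⟩ := h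
  have hI' : List.Forall₂ (fun b ρ => ∃ η, Atom.ground η ρ.1 = Atom.ground θ b ∧
      ∀ c ∈ ρ.2, Atom.ground η c ∈ D) (idbAtoms Pi R) ρs' := by
    refine List.forall₂_iff_get.2 ⟨hI.length_eq.trans hv.length_eq, fun i h1 h2 => ?_⟩
    have h4 : i < ρs.length := hI.length_eq ▸ h1
    obtain ⟨ρ, hρ, η, h5⟩ := ((List.forall₂_iff_get.1 hI).2 i h1 h4).of_variant
      ((List.forall₂_iff_get.1 hv).2 i h4 h2)
    rw [List.mem_singleton.1 hρ] at h5
    exact ⟨η, h5⟩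
  obtain ⟨η, hη, hI'⟩ := exists_common_valuation (θ := θ)
    (Q := fun b ρ η => Atom.ground η ρ.1 = Atom.ground θ b ∧ ∀ c ∈ ρ.2, Atom.ground η c ∈ D)
    (fun b ρ η η' h ⟨h1, h2⟩ => ⟨h1 ▸ (Atom.ground_congr fun v hv =>
      h v ⟨_, List.mem_cons_self, hv⟩).symm, fun c hc => Atom.ground_congr (fun v hv =>
      h v ⟨_, List.mem_cons_of_mem _ hc, hv⟩) ▸ h2 c hc⟩) hI' hd hp
  have hgr : ∀ b ∈ Rule.atoms R, Atom.ground θ b = Atom.ground η b := fun b hb =>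
    Atom.ground_congr fun v hv => (hη v ⟨b, hb, hv⟩).symm
  have hs : ∀ t, Term.subst (fun v => (Sum.inr (η v) : Term)) t = Sum.inr (Term.ground η t) := by
    intro t; cases t <;> rfl
  have hs' : ∀ l : List Term, l.map (Term.subst fun v => (Sum.inr (η v) : Term)) =
      (l.map (Term.ground η)).map Sum.inr := by
    intro l; simp [hs]
  -- The glued valuation, read as a ground substitution, unifies the pairs. So the branch without a
  -- unifier is impossible, and `η` factors through `σ`.
  have hu : IsUnifier (fun v => (Sum.inr (η v) : Term)) (unifPairs Pi R ρs') := by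
    rw [isUnifier_unifPairs hI'.length_eq]
    refine List.forall₂_iff_get.2 ⟨hI'.length_eq, fun i h1 h2 => ?_⟩
    have h3 := ((List.forall₂_iff_get.1 hI').2 i h1 h2).1
    rw [hgr _ (List.mem_cons_of_mem _ (mem_idbAtoms.1 (List.get_mem _ _)).1)] at h3
    rw [hs', hs']
    exact congrArg _ (congrArg Prod.snd h3).symm
  obtain ⟨hn, -⟩ | ⟨σ, R', hσ, rfl, h⟩ := h
  · exact absurd ⟨_, hu⟩ hn
  obtain ⟨τ, hτ⟩ := hσ.2 _ hu
  have hτ' : ∀ a : Atom ℕ, Atom.ground (fun v => Term.ground (fun w => Term.ground η (τ w)) (σ v)) a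
      = Atom.ground η a := by
    intro a
    refine Atom.ground_congr fun v _ => ?_
    rw [← Term.ground_subst, ← hτ v]; rfl
  have hcov : Covers [inlined Pi R ρs' σ] D (Atom.ground θ R.1) := by
    -- Outside the range of `σ` the terms `τ w` may contain variables, so they are evaluated by `η`.
    refine ⟨_, List.mem_singleton_self _, fun w => Term.ground η (τ w), ?_, fun b hb => ?_⟩
    · rw [hgr _ List.mem_cons_self]
      exact (Atom.ground_subst _ _ _).trans (hτ' _)
    · simp only [inlined, List.mem_append, List.mem_flatMap, List.mem_map] at hb
      obtain ⟨ρ, hρ, b, hb, rfl⟩ | ⟨b, hb, rfl⟩ := hb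
      · rw [Atom.ground_subst, hτ']
        obtain ⟨i, hi⟩ := List.get_of_mem hρ
        have h4 : i.1 < (idbAtoms Pi R).length := i.2.trans_eq hI'.length_eq.symm
        have h3 := ((List.forall₂_iff_get.1 hI').2 i h4 i.2).2
        simp only [hi] at h3
        exact h3 b hb
      · rw [Atom.ground_subst, hτ', ← hgr _ (List.mem_cons_of_mem _ (mem_edbAtoms.1 hb).1)]
        exact hE b hb
  obtain ⟨hh, rfl⟩ | ⟨-, rfl⟩ := h
  -- Under either clause of `hCont` an adornment already present subsumes the dropped one: `ρ'` by
  -- clause (1), a variant by clause (2).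
  · obtain ⟨ρ, h1, -, ρ', h2, -, h3⟩ | ⟨R'', h1, f, h2⟩ := hh
    · obtain rfl : inlined Pi R ρs' σ = ρ := Sum.inr_injective h1
      exact hcov.of_subsumes h3 (mem_adornments.2 h2)
    · obtain ⟨⟨p, l⟩, B⟩ := R''
      have h3 := (List.forall₂_cons.1 h2).1.1
      rcases p with e | ρ'
      · exact h3.elim
      · exact hcov.of_subsumes (Rule.Variant.symm h3).subsumes (mem_adornments_of_head h1 rfl)
  · refine hcov.mono ?_ subset_rfl
    refine List.cons_subset.2 ⟨mem_adornments_of_head (List.mem_append_right _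
      (List.mem_singleton_self _)) rfl, List.nil_subset _⟩

/-- Each adornment occurs in the head of a rule. -/
def HeadsComplete (A : AProg) : Prop := ∀ ρ ∈ adornments A, ∃ R ∈ A, R.1.1 = (Sum.inr ρ : APred)

theorem Pass.covers {Pi : Prog} {A A' : AProg} (h : Pass id hCont Pi A A')
    (hA : HeadsComplete A) {R : Rule ℕ} (hR : R ∈ Pi) {D : Set Fact} {θ : ℕ → ℕ}
    (hb : BodyCovered Pi (adornments A) D R θ) :
    Covers (adornments A') D (Atom.ground θ R.1) := by
  have hex : ∀ b : Atom ℕ, ∃ ρ : Rule ℕ, b ∈ idbAtoms Pi R →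
      ρ ∈ adornments A ∧ Covers [ρ] D (Atom.ground θ b) := by
    intro b
    by_cases hb' : b ∈ idbAtoms Pi R
    · obtain ⟨ρ, h1, h2⟩ := (hb b (mem_idbAtoms.1 hb').1).1 (mem_idbAtoms.1 hb').2
      exact ⟨ρ, fun _ => ⟨h1, ρ, by simp, h2⟩⟩
    -- `R` is a dummy value for atoms that are not IDB atoms of the body.
    · exact ⟨R, fun h => absurd h hb'⟩
  choose r hr using hex
  have hch : IsChoice Pi R A ((idbAtoms Pi R).map r) := by
    unfold IsChoice
    rw [List.forall₂_map_right_iff, List.forall₂_same]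
    intro b hb
    obtain ⟨h1, ρ, h2, η, h3, -⟩ := hr b hb
    rw [List.mem_singleton.1 h2] at h3
    exact ⟨congrArg (fun f : Fact => f.1) h3, hA _ h1⟩
  obtain ⟨B, B', -, h1, h2⟩ := h.exists_innerBody hR hch
  refine (h1.covers ?_ fun b hb' => ?_).mono (adornments_mono h2.subset) subset_rfl
  · rw [List.forall₂_map_right_iff, List.forall₂_same]
    exact fun b hb => (hr b hb).2
  · exact (hb b (mem_edbAtoms.1 hb').1).2 (mem_edbAtoms.1 hb').2

/-! ### Soundness of the adornments -/

theorem exists_of_mem_zipWith {α β γ : Type*} {f : α → β → γ} {l : List α} {m : List β} {x : γ}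
    (h : x ∈ List.zipWith f l m) : ∃ a ∈ l, ∃ b ∈ m, f a b = x := by
  rw [← List.map_uncurry_zip_eq_zipWith, List.mem_map] at h
  obtain ⟨⟨a, b⟩, h1, h2⟩ := h
  exact ⟨a, (List.of_mem_zip h1).1, b, (List.of_mem_zip h1).2, h2⟩

theorem exists_of_forall₂_left {α β : Type*} {r : α → β → Prop} {l : List α} {m : List β}
    (h : List.Forall₂ r l m) {x : α} (hx : x ∈ l) : ∃ y ∈ m, r x y := by
  induction h with
  | nil => simp at hx
  | cons h _ ih =>
    rcases List.mem_cons.1 hx with rfl | hx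
    · exact ⟨_, List.mem_cons_self, h⟩
    · obtain ⟨y, hy, h⟩ := ih hx
      exact ⟨y, List.mem_cons_of_mem _ hy, h⟩

/-- All constants of the rule `R` are less than `C`. -/
def Rule.ConstsLT {P : Type} (C : ℕ) (R : Rule P) : Prop :=
  ∀ a ∈ Rule.atoms R, ∀ c : ℕ, (Sum.inr c : Term) ∈ a.2 → c < C

theorem Rule.ConstsLT.renameBy {P : Type} {C : ℕ} {R : Rule P} (h : Rule.ConstsLT C R)
    (f : Equiv.Perm ℕ) : Rule.ConstsLT C (Rule.subst (renameBy f) R) := by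
  intro a ha c hc
  rw [Rule.atoms_subst, List.mem_map] at ha
  obtain ⟨a, ha, rfl⟩ := ha
  obtain ⟨t, ht, h'⟩ := List.mem_map.1 hc
  cases t with
  | inl v => simp [Term.subst, Datalog.renameBy] at h'
  | inr d =>
    obtain rfl : d = c := by simpa [Term.subst] using h'
    exact h a ha d ht

theorem safe_subst {R : Rule ℕ} {σ : ℕ → Term} {v : ℕ} (hs : Rule.Safe R)
    (hv : Atom.HasVar (Atom.subst σ R.1) v) : ∃ b ∈ R.2, Atom.HasVar (Atom.subst σ b) v := by
  obtain ⟨t, ht, h⟩ := List.mem_map.1 hv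
  cases t with
  | inl w =>
    obtain ⟨b, hb, hw⟩ := hs w ht
    exact ⟨b, hb, List.mem_map.2 ⟨_, hw, h⟩⟩
  | inr c => simp [Term.subst] at h

theorem Unfolding.subst {Pi : Prog} {ρ : Rule ℕ} (h : Unfolding Pi ρ) (σ : ℕ → Term) :
    Unfolding Pi (Rule.subst σ ρ) where
  head := h.head
  body b hb := by
    obtain ⟨b, hb', rfl⟩ := List.mem_map.1 hb
    exact h.body b hb'
  arity a ha := by
    rw [Rule.atoms_subst, List.mem_map] at ha
    obtain ⟨a, ha, rfl⟩ := ha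
    simpa [Atom.subst] using h.arity a ha
  safe v hv := by
    obtain ⟨b, hb, h⟩ := safe_subst h.safe hv
    exact ⟨_, List.mem_map_of_mem hb, h⟩
  derives := h.derives.subst σ

section Inlined

variable {Pi : Prog} {R : Rule ℕ} {ρs : List (Rule ℕ)} {σ : ℕ → Term}

/-- Under the unifier each IDB body atom of `R` becomes the head of an instantiated adornment.
Derivations therefore compose, and safety passes from `R` through the adornments to their bodies. -/
theorem unfolding_inlined (hPi : IsDatalog Pi) (hR : R ∈ Pi) (hρs : ∀ ρ ∈ ρs, Unfolding Pi ρ)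
    (hp : List.Forall₂ (fun b ρ => ρ.1.1 = b.1) (idbAtoms Pi R) ρs)
    (hσ : IsUnifier σ (unifPairs Pi R ρs)) : Unfolding Pi (inlined Pi R ρs σ) := by
  rw [isUnifier_unifPairs hp.length_eq] at hσ
  have hi : ∀ b ∈ R.2, b.1 ∈ idb Pi → ∃ ρ ∈ ρs, Atom.subst σ b = Atom.subst σ ρ.1 := by
    intro b hb hb'
    have h : List.Forall₂ (fun b ρ => Atom.subst σ b = Atom.subst σ ρ.1) (idbAtoms Pi R) ρs :=
      List.forall₂_iff_get.2 ⟨hp.length_eq, fun i h1 h2 => Prod.ext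
        ((List.forall₂_iff_get.1 hp).2 i h1 h2).symm ((List.forall₂_iff_get.1 hσ).2 i h1 h2)⟩
    exact exists_of_forall₂_left h (mem_idbAtoms.2 ⟨hb, hb'⟩)
  have hbody : ∀ c ∈ (inlined Pi R ρs σ).2, (∃ ρ ∈ ρs, ∃ b ∈ ρ.2, Atom.subst σ b = c) ∨
      ∃ b ∈ edbAtoms Pi R, Atom.subst σ b = c := by
    intro c hc
    simpa [inlined] using hc
  have hsub : ∀ ρ ∈ ρs, ρ.2.map (Atom.subst σ) ⊆ (inlined Pi R ρs σ).2 := fun ρ hρ c hc =>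
    List.mem_append_left _ (List.mem_flatMap.2 ⟨ρ, hρ, hc⟩)
  have hsub' : ∀ b ∈ R.2, b.1 ∉ idb Pi → Atom.subst σ b ∈ (inlined Pi R ρs σ).2 :=
    fun b hb hb' => List.mem_append_right _ (List.mem_map_of_mem (mem_edbAtoms.2 ⟨hb, hb'⟩))
  refine ⟨hPi.2.2 R hR, fun c hc => ?_, fun a ha => ?_, fun v hv => ?_, ?_⟩
  · obtain ⟨ρ, hρ, b, hb, rfl⟩ | ⟨b, hb, rfl⟩ := hbody c hc
    · exact (hρs ρ hρ).body b hb
    · exact (mem_edbAtoms.1 hb).2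
  · rcases List.mem_cons.1 ha with rfl | ha
    · exact ⟨R.1, ⟨R, hR, List.mem_cons_self⟩, rfl, by simp [inlined, Atom.subst]⟩
    · obtain ⟨ρ, hρ, b, hb, rfl⟩ | ⟨b, hb, rfl⟩ := hbody a ha
      · simpa [Atom.subst] using (hρs ρ hρ).arity b (List.mem_cons_of_mem _ hb)
      · exact ⟨b, ⟨R, hR, List.mem_cons_of_mem _ (mem_edbAtoms.1 hb).1⟩, rfl,
          by simp [Atom.subst]⟩
  · obtain ⟨b, hb, h⟩ := safe_subst (hPi.2.1 R hR) hv
    by_cases hb' : b.1 ∈ idb Pi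
    · obtain ⟨ρ, hρ, he⟩ := hi b hb hb'
      rw [he] at h
      obtain ⟨c, hc, h⟩ := safe_subst (hρs ρ hρ).safe h
      exact ⟨_, hsub ρ hρ (List.mem_map_of_mem hc), h⟩
    · exact ⟨_, hsub' b hb hb', h⟩
  · refine .step R hR σ fun b hb => ?_
    by_cases hb' : b.1 ∈ idb Pi
    · obtain ⟨ρ, hρ, he⟩ := hi b hb hb'
      rw [he]
      exact ((hρs ρ hρ).derives.subst σ).mono (hsub ρ hρ)
    · exact .base _ (hsub' b hb hb')

theorem const_lt_of_isMGU {C : ℕ} (hR : Rule.ConstsLT C R)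
    (hρs : ∀ ρ ∈ ρs, Rule.ConstsLT C ρ) (hσ : IsMGU σ (unifPairs Pi R ρs)) {t : Term}
    (ht : ∀ c, t = Sum.inr c → c < C) {c : ℕ} (h : Term.subst σ t = Sum.inr c) : c < C := by
  cases t with
  | inr d => exact ht c h
  | inl v =>
    obtain ⟨e, he, hc⟩ := hσ.const_mem h
    obtain ⟨b, hb, ρ, hρ, rfl⟩ := exists_of_mem_zipWith he
    rcases hc with hc | hc
    · exact hR b (List.mem_cons_of_mem _ (mem_idbAtoms.1 hb).1) c hc
    · exact hρs ρ hρ ρ.1 List.mem_cons_self c hc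

theorem constsLT_inlined {C : ℕ} (hR : Rule.ConstsLT C R)
    (hρs : ∀ ρ ∈ ρs, Rule.ConstsLT C ρ) (hσ : IsMGU σ (unifPairs Pi R ρs)) :
    Rule.ConstsLT C (inlined Pi R ρs σ) := by
  have key : ∀ a : Atom ℕ, (∀ c, (Sum.inr c : Term) ∈ a.2 → c < C) →
      ∀ c, (Sum.inr c : Term) ∈ (Atom.subst σ a).2 → c < C := by
    intro a ha c hc
    obtain ⟨t, ht, h⟩ := List.mem_map.1 hc
    exact const_lt_of_isMGU hR hρs hσ (fun c hc => ha c (hc ▸ ht)) h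
  intro a ha
  simp only [Rule.atoms, inlined, List.mem_cons, List.mem_append, List.mem_flatMap,
    List.mem_map] at ha
  obtain rfl | ⟨ρ, hρ, b, hb, rfl⟩ | ⟨b, hb, rfl⟩ := ha
  · exact key _ (hR _ List.mem_cons_self)
  · exact key _ (hρs ρ hρ _ (List.mem_cons_of_mem _ hb))
  · exact key _ (hR _ (List.mem_cons_of_mem _ (mem_edbAtoms.1 hb).1))

theorem adornments_adornedRule {ρs : List (Rule ℕ)} {ρ : Rule ℕ} :
    adornments [adornedRule Pi R ρs σ ρ] ⊆ ρ :: ρs := by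
  intro ρ' h
  simp only [adornments, List.flatMap_singleton, List.mem_filterMap, Rule.atoms, adornedRule,
    Sum.getRight?_eq_some_iff] at h
  obtain ⟨a, ha, h⟩ := h
  rcases List.mem_cons.1 ha with rfl | ha
  · obtain rfl := Sum.inr_injective h
    exact List.mem_cons_self
  · rcases List.mem_append.1 ha with ha | ha
    · obtain ⟨b, -, ρ'', hρ, rfl⟩ := exists_of_mem_zipWith ha
      obtain rfl := Sum.inr_injective h
      exact List.mem_cons_of_mem _ hρ
    · obtain ⟨b, -, rfl⟩ := List.mem_map.1 ha
      simp at h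

end Inlined

/-- The properties of adorned programs preserved by the algorithm. -/
structure Sound (Pi : Prog) (C : ℕ) (A : AProg) : Prop where
  heads : HeadsComplete A
  unfolding : ∀ ρ ∈ adornments A, Unfolding Pi ρ
  consts : ∀ ρ ∈ adornments A, Rule.ConstsLT C ρ

theorem Sound.nil (Pi : Prog) (C : ℕ) : Sound Pi C [] :=
  ⟨fun _ h => by simp [adornments] at h, fun _ h => by simp [adornments] at h,
    fun _ h => by simp [adornments] at h⟩

/-! ### Preservation of soundness during a run -/

section Step

variable {Pi : Prog} {C : ℕ} {R : Rule ℕ} {ρs ρs' : List (Rule ℕ)} {A : AProg} {σ : ℕ → Term}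

theorem Sound.renamed (hA : Sound Pi C A) (hch : IsChoice Pi R A ρs)
    (hv : List.Forall₂ Rule.Variant ρs ρs') :
    (∀ ρ ∈ ρs', Unfolding Pi ρ) ∧ (∀ ρ ∈ ρs', Rule.ConstsLT C ρ) ∧
      List.Forall₂ (fun b ρ => ρ.1.1 = b.1) (idbAtoms Pi R) ρs' := by
  have key : ∀ ρ ∈ ρs', ∃ ρ₀ ∈ ρs, Rule.Variant ρ₀ ρ := fun ρ hρ =>
    exists_of_forall₂_left hv.flip hρ
  refine ⟨fun ρ hρ => ?_, fun ρ hρ => ?_, List.forall₂_iff_get.2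
    ⟨hch.length_eq.trans hv.length_eq, fun i h1 h2 => ?_⟩⟩
  · obtain ⟨ρ₀, h, f, rfl⟩ := key ρ hρ
    exact (hA.unfolding _ (hch.subset_adornments h)).subst _
  · obtain ⟨ρ₀, h, f, rfl⟩ := key ρ hρ
    exact (hA.consts _ (hch.subset_adornments h)).renameBy f
  · have h3 : i < ρs.length := hch.length_eq ▸ h1
    obtain ⟨f, hf⟩ := (List.forall₂_iff_get.1 hv).2 i h3 h2
    rw [hf]
    exact ((List.forall₂_iff_get.1 hch).2 i h1 h3).1

theorem Sound.inlined (hA : Sound Pi C A) (hPi : IsDatalog Pi) (hC : ∀ R ∈ Pi, Rule.ConstsLT C R)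
    (hR : R ∈ Pi) (hch : IsChoice Pi R A ρs) (hv : List.Forall₂ Rule.Variant ρs ρs')
    (hσ : IsMGU σ (unifPairs Pi R ρs')) :
    Unfolding Pi (inlined Pi R ρs' σ) ∧ Rule.ConstsLT C (inlined Pi R ρs' σ) := by
  obtain ⟨h1, h2, h3⟩ := hA.renamed hch hv
  exact ⟨unfolding_inlined hPi hR h1 h3 hσ.1, constsLT_inlined (hC R hR) h2 hσ⟩

theorem adornments_append_adornedRule {ρ : Rule ℕ} (hch : IsChoice Pi R A ρs) :
    adornments (A ++ [adornedRule Pi R ρs σ ρ]) ⊆ ρ :: adornments A := by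
  rw [adornments_append]
  refine List.append_subset.2 ⟨List.subset_cons_self _ _,
    List.Subset.trans adornments_adornedRule (List.cons_subset_cons _ hch.subset_adornments)⟩

theorem Sound.innerBody {A' : AProg} (hA : Sound Pi C A) (hPi : IsDatalog Pi)
    (hC : ∀ R ∈ Pi, Rule.ConstsLT C R) (hR : R ∈ Pi) (hch : IsChoice Pi R A ρs)
    (h : innerBody id hCont Pi R ρs A A') : Sound Pi C A' := by
  obtain ⟨ρs', ⟨hv, -⟩, ⟨-, rfl⟩ | ⟨σ, R', hσ, rfl, ⟨-, rfl⟩ | ⟨-, rfl⟩⟩⟩ := h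
  · exact hA
  · exact hA
  have hi := hA.inlined hPi hC hR hch hv hσ
  have hsub := adornments_append_adornedRule (σ := σ) (ρ := id (Datalog.inlined Pi R ρs' σ)) hch
  refine ⟨fun ρ hρ => ?_, fun ρ hρ => ?_, fun ρ hρ => ?_⟩ <;>
    rcases List.mem_cons.1 (hsub hρ) with rfl | hρ
  · exact ⟨_, List.mem_append_right _ (List.mem_singleton_self _), rfl⟩
  · obtain ⟨R, h1, h2⟩ := hA.heads ρ hρ
    exact ⟨R, List.mem_append_left _ h1, h2⟩
  · exact hi.1
  · exact hA.unfolding ρ hρ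
  · exact hi.2
  · exact hA.consts ρ hρ

end Step

theorem IsRun.sound {Pi : Prog} {C : ℕ} {A : ℕ → AProg} (h : IsRun id hCont Pi A)
    (hPi : IsDatalog Pi) (hC : ∀ R ∈ Pi, Rule.ConstsLT C R) (n : ℕ) : Sound Pi C (A n) :=
  h.invariant (Sound Pi C) (fun _ hR _ _ _ hch hb hB => hB.innerBody hPi hC hR hch hb)
    (m := 0) (by rw [h.1]; exact Sound.nil Pi C) (Nat.zero_le n)

theorem Atom.exists_const_bound {P : Type} (a : Atom P) :
    ∃ C, ∀ c, (Sum.inr c : Term) ∈ a.2 → c < C := by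
  have h : {c : ℕ | (Sum.inr c : Term) ∈ a.2}.Finite :=
    Set.Finite.preimage (Sum.inr_injective.injOn) a.2.finite_toSet
  obtain ⟨M, hM⟩ := h.bddAbove
  exact ⟨M + 1, fun v hv => Nat.lt_succ_of_le (hM hv)⟩

theorem exists_const_bound {P : Type} (Pi : Program P) : ∃ C, ∀ R ∈ Pi, Rule.ConstsLT C R :=
  exists_uniform_bound Pi (fun R C => Rule.ConstsLT C R)
    (fun R _ => exists_uniform_bound (Rule.atoms R) (fun a C => ∀ c, (Sum.inr c : Term) ∈ a.2 → c < C)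
      (fun a _ => Atom.exists_const_bound a) (fun _ _ _ h h' c hc => (h' c hc).trans_le h))
    (fun _ _ _ h h' a ha c hc => (h' a ha c hc).trans_le h)

/-! ### Fixpoints are closed, and every derivation is covered eventually -/

theorem IsRun.closed_of_eq {Pi : Prog} {A : ℕ → AProg} (h : IsRun id hCont Pi A)
    (hPi : IsDatalog Pi) {n : ℕ} (hn : A (n + 1) = A n) : Closed Pi (adornments (A n)) := by
  obtain ⟨C, hC⟩ := exists_const_bound Pi
  intro D R hR θ hb
  exact hn ▸ (h.2 n).covers (h.sound hPi hC n).heads hR hb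

theorem IsRun.bounded_of_terminates {Pi : Prog} {A : ℕ → AProg} (h : IsRun id hCont Pi A)
    (hPi : IsDatalog Pi) (ht : Terminates A) : Bounded Pi := by
  obtain ⟨C, hC⟩ := exists_const_bound Pi
  obtain ⟨n, hn⟩ := ht
  exact bounded_of_closed hPi (h.sound hPi hC n).unfolding (h.closed_of_eq hPi hn)

/-- Induction on the derivation: coverage is monotone in the stage, so the finitely many body atoms
have a common stage, and the next pass covers the head. -/
theorem IsRun.exists_covers {Pi : Prog} {A : ℕ → AProg} (h : IsRun id hCont Pi A)
    (hPi : IsDatalog Pi) {D : Finset Fact} (hD : ∀ f ∈ D, f.1 ∉ idb Pi) {f : Fact}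
    (hf : f.1 ∈ idb Pi) (hd : Derives Pi D f) : ∃ n, Covers (adornments (A n)) D f := by
  obtain ⟨C, hC⟩ := exists_const_bound Pi
  induction hd with
  | base f hf' => exact absurd hf (hD f hf')
  | step R hR θ hb ih =>
    obtain ⟨n, hn⟩ := exists_uniform_bound R.2
      (fun b n => b.1 ∈ idb Pi → Covers (adornments (A n)) D (Atom.ground θ b))
      (fun b hb => by
        by_cases hi : b.1 ∈ idb Pi
        · obtain ⟨n, hn⟩ := ih b hb hi
          exact ⟨n, fun _ => hn⟩
        · exact ⟨0, fun h => absurd h hi⟩)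
      (fun b m n hmn h' hi => (h' hi).mono (adornments_mono (h.prefix hmn).subset) subset_rfl)
    exact ⟨n + 1, (h.2 n).covers (h.sound hPi hC n).heads hR fun b hb' =>
      ⟨hn b hb', fun hi => ((hb b hb').pred_mem_idb_or_mem hPi).resolve_left hi⟩⟩

/-! ### Renaming of constants -/

/-- Compresses the values in `L` into an initial segment while fixing the protected ones below `C`:
each new value that is too large is swapped with the next free place. -/
theorem exists_perm_lt (C : ℕ) (L : List ℕ) :
    ∃ f : Equiv.Perm ℕ, (∀ x < C, f x = x) ∧ ∀ v ∈ L, f v < C + L.length := by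
  induction L with
  | nil => exact ⟨Equiv.refl ℕ, fun _ _ => rfl, by simp⟩
  | cons v L ih =>
    obtain ⟨f, h1, h2⟩ := ih
    by_cases hv : f v < C + L.length
    · refine ⟨f, h1, fun w hw => ?_⟩
      rw [List.length_cons]
      rcases List.mem_cons.1 hw with rfl | hw
      · omega
      · have := h2 w hw
        omega
    · have hs : ∀ y < C + L.length, Equiv.swap (f v) (C + L.length) y = y := fun y hy =>
        Equiv.swap_apply_of_ne_of_ne (by omega) (by omega)
      refine ⟨f.trans (Equiv.swap (f v) (C + L.length)), fun x hx => ?_, fun w hw => ?_⟩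
      · rw [Equiv.trans_apply, h1 x hx, hs x (by omega)]
      · rw [List.length_cons, Equiv.trans_apply]
        rcases List.mem_cons.1 hw with rfl | hw
        · rw [Equiv.swap_apply_left]
          omega
        · have := h2 w hw
          rw [hs _ this]
          omega

/-- The fact obtained by replacing the constants by `π`. -/
def Fact.map (π : ℕ → ℕ) (f : Fact) : Fact := (f.1, f.2.map π)

theorem Fact.map_symm_map (π : Equiv.Perm ℕ) (f : Fact) : Fact.map π.symm (Fact.map π f) = f := by
  simp [Fact.map]

theorem Fact.map_ground {π : ℕ → ℕ} {C : ℕ} (hπ : ∀ c < C, π c = c) {θ : ℕ → ℕ} {a : Atom ℕ}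
    (ha : ∀ c : ℕ, (Sum.inr c : Term) ∈ a.2 → c < C) :
    Fact.map π (Atom.ground θ a) = Atom.ground (fun v => π (θ v)) a := by
  refine Prod.ext rfl ?_
  simp only [Fact.map, Atom.ground, List.map_map]
  refine List.map_congr_left fun t ht => ?_
  cases t with
  | inl v => rfl
  | inr c => exact hπ c (ha c ht)

/-- Genericity: rules are positive, so any map fixing the constants of the program carries
derivations to derivations. -/
theorem Derives.map {Pi : Prog} {C : ℕ} (hC : ∀ R ∈ Pi, Rule.ConstsLT C R) {π : ℕ → ℕ}
    (hπ : ∀ c < C, π c = c) {D : Finset Fact} {f : Fact} (h : Derives Pi D f) :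
    Derives Pi (D.image (Fact.map π)) (Fact.map π f) := by
  induction h with
  | base f hf => exact .base _ (Finset.mem_image_of_mem _ hf)
  | step R hR θ _ ih =>
    rw [Fact.map_ground hπ (hC R hR _ List.mem_cons_self)]
    refine .step R hR _ fun b hb => ?_
    rw [← Fact.map_ground hπ (hC R hR _ (List.mem_cons_of_mem _ hb))]
    exact ih b hb

theorem Covers.map {S : List (Rule ℕ)} {C : ℕ} (hC : ∀ R ∈ S, Rule.ConstsLT C R) {π : ℕ → ℕ}
    (hπ : ∀ c < C, π c = c) {D : Set Fact} {f : Fact} (h : Covers S D f) :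
    Covers S (Fact.map π '' D) (Fact.map π f) := by
  obtain ⟨ρ, hρ, θ, rfl, h⟩ := h
  refine ⟨ρ, hρ, fun v => π (θ v), (Fact.map_ground hπ (hC ρ hρ _ List.mem_cons_self)).symm,
    fun b hb => ?_⟩
  rw [← Fact.map_ground hπ (hC ρ hρ _ (List.mem_cons_of_mem _ hb))]
  exact Set.mem_image_of_mem _ (h b hb)

/-- If the body of `ρ`, with its variables frozen to new constants, makes `S` cover the head,
then a rule of `S` subsumes `ρ`. -/
theorem exists_subsumes_of_covers {S : List (Rule ℕ)} {C : ℕ} (hS : ∀ R ∈ S, Rule.ConstsLT C R)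
    {ρ : Rule ℕ} (hρ : Rule.ConstsLT C ρ)
    (h : Covers S {f | ∃ b ∈ ρ.2, f = Atom.ground (fun v => v + C) b}
      (Atom.ground (fun v => v + C) ρ.1)) : ∃ ρ' ∈ S, Subsumes ρ' ρ := by
  obtain ⟨ρ', hρ', θ, h1, h2⟩ := h
  -- `u` undoes the freezing `v ↦ v + C`; composed with the covering valuation it is the required
  -- homomorphism.
  let u : ℕ → Term := fun x => if x < C then Sum.inr x else Sum.inl (x - C)
  have hu : ∀ t : Term, (∀ c : ℕ, t = Sum.inr c → c < C) →
      u (Term.ground (fun v => v + C) t) = t := by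
    intro t ht
    cases t with
    | inl v => simp [u, Term.ground]
    | inr c => simp [u, Term.ground, ht c rfl]
  have hu' : ∀ t : Term, (∀ c : ℕ, t = Sum.inr c → c < C) →
      Term.subst (fun v => u (θ v)) t = u (Term.ground θ t) := by
    intro t ht
    cases t with
    | inl v => rfl
    | inr c => simp [u, Term.ground, ht c rfl, Term.subst]
  have key : ∀ a ∈ Rule.atoms ρ', ∀ b ∈ Rule.atoms ρ,
      Atom.ground θ a = Atom.ground (fun v => v + C) b →
      Atom.subst (fun v => u (θ v)) a = b := by
    intro a ha b hb hab
    refine Prod.ext (congrArg (fun f : Fact => f.1) hab) ?_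
    have h3 : (a.2.map (Term.ground θ)).map u = (b.2.map (Term.ground fun v => v + C)).map u :=
      congrArg (fun f : Fact => f.2.map u) hab
    rw [List.map_map, List.map_map] at h3
    have h4 : b.2.map (u ∘ Term.ground fun v => v + C) = b.2 := by
      conv_rhs => rw [← List.map_id b.2]
      exact List.map_congr_left fun t ht => hu t fun c hc => hρ b hb c (hc ▸ ht)
    rw [h4] at h3
    rw [← h3]
    exact List.map_congr_left fun t ht => hu' t fun c hc => hS ρ' hρ' a ha c (hc ▸ ht)
  refine ⟨ρ', hρ', _, key _ List.mem_cons_self _ List.mem_cons_self h1, fun b hb => ?_⟩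
  obtain ⟨b', hb', h3⟩ := h2 b hb
  exact key b (List.mem_cons_of_mem _ hb) b' (List.mem_cons_of_mem _ hb') h3 ▸ hb'

/-! ### Enumerations of finite sets of lists and facts -/

/-- The lists of length at most `n` with entries from `T`. -/
def lists {α : Type*} (T : List α) : ℕ → List (List α)
  | 0 => [[]]
  | n + 1 => [] :: T.flatMap fun x => (lists T n).map (List.cons x)

theorem mem_lists {α : Type*} {T : List α} {n : ℕ} {l : List α} :
    l ∈ lists T n ↔ l.length ≤ n ∧ ∀ x ∈ l, x ∈ T := by
  induction n generalizing l with
  | zero => cases l <;> simp [lists]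
  | succ n ih =>
    cases l with
    | nil => simp [lists]
    | cons x l =>
      simp [lists, ih]
      grind

/-- The facts with predicate and arity at most `M` and constants less than `K`. -/
def facts (M K : ℕ) : List Fact :=
  (List.range M).flatMap fun p => (lists (List.range K) M).map fun l => (p, l)

theorem mem_facts {M K : ℕ} {f : Fact} :
    f ∈ facts M K ↔ f.1 < M ∧ f.2.length ≤ M ∧ ∀ c ∈ f.2, c < K := by
  obtain ⟨p, l⟩ := f
  simp [facts, mem_lists]

theorem length_flatMap_le {α β : Type*} {l : List α} {g : α → List β} {M : ℕ}
    (h : ∀ x ∈ l, (g x).length ≤ M) : (l.flatMap g).length ≤ l.length * M := by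
  induction l with
  | nil => simp
  | cons x l ih =>
    have h1 := h x List.mem_cons_self
    have h2 := ih fun y hy => h y (List.mem_cons_of_mem _ hy)
    rw [List.flatMap_cons, List.length_append, List.length_cons, Nat.succ_mul]
    omega

/-! ### Numerical bounds for programs -/

/-- `M` bounds everything that occurs in the rule `R`. -/
def Rule.BoundedBy (M : ℕ) (R : Rule ℕ) : Prop :=
  R.2.length ≤ M ∧ ∀ a ∈ Rule.atoms R, a.1 < M ∧ a.2.length ≤ M ∧
    ∀ t ∈ a.2, (∀ v, t = Sum.inl v → v < M) ∧ ∀ c, t = Sum.inr c → c < M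

theorem Rule.BoundedBy.mono {M N : ℕ} {R : Rule ℕ} (h : Rule.BoundedBy M R) (hMN : M ≤ N) :
    Rule.BoundedBy N R :=
  ⟨h.1.trans hMN, fun a ha => ⟨(h.2 a ha).1.trans_le hMN, (h.2 a ha).2.1.trans hMN, fun t ht =>
    ⟨fun v hv => (((h.2 a ha).2.2 t ht).1 v hv).trans_le hMN,
      fun v hv => (((h.2 a ha).2.2 t ht).2 v hv).trans_le hMN⟩⟩⟩

theorem Rule.BoundedBy.constsLT {M : ℕ} {R : Rule ℕ} (h : Rule.BoundedBy M R) :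
    Rule.ConstsLT M R := fun a ha c hc => ((h.2 a ha).2.2 _ hc).2 c rfl

theorem exists_boundedBy (Pi : Prog) : ∃ M, ∀ R ∈ Pi, Rule.BoundedBy M R := by
  refine exists_uniform_bound Pi (fun R M => Rule.BoundedBy M R) (fun R _ => ?_)
    (fun _ _ _ h h' => h'.mono h)
  obtain ⟨C, hC⟩ := exists_const_bound [R]
  obtain ⟨V, hV⟩ := Rule.exists_var_bound R
  obtain ⟨N, hN⟩ := exists_uniform_bound (Rule.atoms R) (fun a N => a.1 < N ∧ a.2.length ≤ N)
    (fun a _ => ⟨a.1 + 1 + a.2.length, by omega, by omega⟩) (fun _ _ _ h h' => by omega)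
  refine ⟨C + V + N + R.2.length, by omega, fun a ha => ?_⟩
  have h1 := hN a ha
  refine ⟨by omega, by omega, fun t ht => ⟨?_, ?_⟩⟩
  · rintro v rfl
    have := hV v ⟨a, ha, ht⟩
    omega
  · rintro c rfl
    have := hC R (by simp) a ha c ht
    omega

/-! ### Derivations of non-recursive programs use a bounded number of facts -/

/-- Induction on the number of predicates reachable from `p`. It drops strictly along a dependency
from `p` to `q`, since `q` is reachable from `p` but not from itself. -/
theorem exists_support_bound {Pi : Prog} (hPi : Program.Nonrecursive Pi) (p : ℕ) :
    ∃ N, ∀ D f, f.1 = p → Derives Pi D f → ∃ D₀ ⊆ D, D₀.card ≤ N ∧ Derives Pi D₀ f := by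
  classical
  let reach : ℕ → Set ℕ := fun p => {q | Relation.TransGen (Program.Depends Pi) p q}
  have hfin : ∀ p, (reach p).Finite := by
    intro p
    refine (List.finite_toSet (Pi.flatMap fun R => R.2.map Prod.fst)).subset fun q hq => ?_
    obtain ⟨r, -, R, hR, -, b, hb, rfl⟩ := Relation.TransGen.tail'_iff.1 hq
    exact List.mem_flatMap.2 ⟨R, hR, List.mem_map_of_mem hb⟩
  induction hn : (reach p).ncard using Nat.strong_induction_on generalizing p with
  | _ n ih =>
    have hex : ∀ q, ∃ N, Program.Depends Pi p q →
        ∀ D f, f.1 = q → Derives Pi D f → ∃ D₀ ⊆ D, D₀.card ≤ N ∧ Derives Pi D₀ f := by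
      intro q
      by_cases hq : Program.Depends Pi p q
      · obtain ⟨N, hN⟩ := ih (reach q).ncard (hn ▸ Set.ncard_lt_ncard
          ⟨fun r hr => Relation.TransGen.head hq hr, fun h => hPi q (h (.single hq))⟩ (hfin p)) q rfl
        exact ⟨N, fun _ => hN⟩
      · exact ⟨0, fun h => absurd h hq⟩
    choose N hN using hex
    -- The summand `1` serves database facts; the sum dominates the supports of the body of
    -- whichever rule is used last.
    refine ⟨1 + ∑ R ∈ Pi.toFinset, ∑ b ∈ R.2.toFinset, N b.1, fun D f hf hd => ?_⟩
    cases hd with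
    | base f hf' =>
      exact ⟨{f}, by simpa using hf', by simp, .base f (by simp)⟩
    | step R hR θ hb =>
      have hb' : ∀ b : Atom ℕ, ∃ D₀ : Finset Fact, b ∈ R.2 →
          D₀ ⊆ D ∧ D₀.card ≤ N b.1 ∧ Derives Pi D₀ (Atom.ground θ b) := by
        intro b
        by_cases h : b ∈ R.2
        · obtain ⟨D₀, h1, h2, h3⟩ := hN b.1 ⟨R, hR, hf, b, h, rfl⟩ D _ rfl (hb b h)
          exact ⟨D₀, fun _ => ⟨h1, h2, h3⟩⟩
        · exact ⟨∅, fun h' => absurd h' h⟩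
      choose E hE using hb'
      refine ⟨R.2.toFinset.biUnion E, ?_, ?_, .step R hR θ fun b hb => ?_⟩
      · exact Finset.biUnion_subset.2 fun b hb => (hE b (List.mem_toFinset.1 hb)).1
      · calc (R.2.toFinset.biUnion E).card ≤ ∑ b ∈ R.2.toFinset, (E b).card :=
              Finset.card_biUnion_le
          _ ≤ ∑ b ∈ R.2.toFinset, N b.1 :=
              Finset.sum_le_sum fun b hb => (hE b (List.mem_toFinset.1 hb)).2.1
          _ ≤ ∑ R ∈ Pi.toFinset, ∑ b ∈ R.2.toFinset, N b.1 :=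
              Finset.single_le_sum (f := fun R : Rule ℕ => ∑ b ∈ R.2.toFinset, N b.1)
                (fun _ _ => Nat.zero_le _) (List.mem_toFinset.2 hR)
          _ ≤ _ := Nat.le_add_left _ _
      · exact (hE b hb).2.2.mono (Finset.subset_biUnion_of_mem E (List.mem_toFinset.2 hb))

theorem Derives.fact_bounds {Pi : Prog} {M : ℕ} (hM : ∀ R ∈ Pi, Rule.BoundedBy M R)
    {D : Finset Fact} (hD : ∀ f ∈ D, f.1 ∉ idb Pi) {f : Fact} (h : Derives Pi D f)
    (hf : f.1 ∈ idb Pi) : f.1 < M ∧ f.2.length ≤ M := by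
  cases h with
  | base f hf' => exact absurd hf (hD f hf')
  | step R hR θ _ =>
    have := (hM R hR).2 R.1 List.mem_cons_self
    exact ⟨this.1, by simpa [Atom.ground] using this.2.1⟩

theorem IsEDB.fact_bounds {Pi : Prog} {M : ℕ} (hM : ∀ R ∈ Pi, Rule.BoundedBy M R)
    {D : Finset Fact} (hD : IsEDB Pi D) {f : Fact} (hf : f ∈ D) : f.1 < M ∧ f.2.length ≤ M := by
  obtain ⟨-, a, ⟨R, hR, ha⟩, h1, h2⟩ := hD f hf
  have := (hM R hR).2 a ha
  exact ⟨h1 ▸ this.1, h2 ▸ this.2.1⟩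

theorem IsEDB.image_map {Pi : Prog} {D : Finset Fact} (hD : IsEDB Pi D) (π : ℕ → ℕ) :
    IsEDB Pi (D.image (Fact.map π)) := by
  intro f hf
  obtain ⟨g, hg, rfl⟩ := Finset.mem_image.1 hf
  obtain ⟨h1, a, h2, h3, h4⟩ := hD g hg
  exact ⟨h1, a, h2, h3, by simpa [Fact.map] using h4⟩

/-- If `Pi` is bounded, then some stage of the algorithm already covers all derivable facts. -/
theorem IsRun.exists_stage {Pi : Prog} {A : ℕ → AProg} (h : IsRun id hCont Pi A)
    (hPi : IsDatalog Pi) (hb : Bounded Pi) : ∃ n, ∀ D f, IsEDB Pi D → f.1 ∈ idb Pi →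
      Derives Pi D f → Covers (adornments (A n)) D f := by
  obtain ⟨M, hM⟩ := exists_boundedBy Pi
  have hC : ∀ R ∈ Pi, Rule.ConstsLT M R := fun R hR => (hM R hR).constsLT
  obtain ⟨Pi', hnon, -, -, -, heq⟩ := hb
  obtain ⟨N, hN⟩ := exists_uniform_bound (idb Pi)
    (fun p N => ∀ D f, f.1 = p → Derives Pi' D f → ∃ D₀ ⊆ D, D₀.card ≤ N ∧ Derives Pi' D₀ f)
    (fun p _ => exists_support_bound hnon p) (fun _ _ _ hmn h' D f h1 h2 => by
      obtain ⟨D₀, h3, h4, h5⟩ := h' D f h1 h2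
      exact ⟨D₀, h3, h4.trans hmn, h5⟩)
  -- Equivalence is used twice: on `D` to enter the non-recursive program, and on the small support
  -- `D₀` to return to `Pi`.
  have hsupp : ∀ D f, IsEDB Pi D → f.1 ∈ idb Pi → Derives Pi D f →
      ∃ D₀ ⊆ D, D₀.card ≤ N ∧ Derives Pi D₀ f := by
    intro D f hD hf hd
    obtain ⟨D₀, h1, h2, h3⟩ := hN f.1 hf D f rfl ((heq D hD f.1 hf f.2).1 hd)
    exact ⟨D₀, h1, h2, (heq D₀ (fun g hg => hD g (h1 hg)) f.1 hf f.2).2 h3⟩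
  -- `M` places for the constants of `Pi`, `N * M` for those of at most `N` facts of arity at most
  -- `M`, and `M` for those of the derived fact.
  let K := M + (N * M + M)
  obtain ⟨n, hn⟩ := exists_uniform_bound
    ((facts M K).toFinset.powerset ×ˢ (facts M K).toFinset).toList
    (fun x n => IsEDB Pi x.1 → x.2.1 ∈ idb Pi → Derives Pi x.1 x.2 →
      Covers (adornments (A n)) x.1 x.2)
    (fun x _ => by
      by_cases hx : IsEDB Pi x.1 ∧ x.2.1 ∈ idb Pi ∧ Derives Pi x.1 x.2
      · obtain ⟨n, hn⟩ := h.exists_covers hPi (fun f hf => (hx.1 f hf).1) hx.2.1 hx.2.2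
        exact ⟨n, fun _ _ _ => hn⟩
      · exact ⟨0, fun h1 h2 h3 => absurd ⟨h1, h2, h3⟩ hx⟩)
    (fun x m n hmn h' h1 h2 h3 =>
      (h' h1 h2 h3).mono (adornments_mono (h.prefix hmn).subset) subset_rfl)
  refine ⟨n, fun D f hD hf hd => ?_⟩
  obtain ⟨D₀, h1, h2, h3⟩ := hsupp D f hD hf hd
  have hD₀ : IsEDB Pi D₀ := fun g hg => hD g (h1 hg)
  have hfb := h3.fact_bounds hM (fun f hf => (hD₀ f hf).1) hf
  obtain ⟨π, hπ1, hπ2⟩ := exists_perm_lt M (D₀.toList.flatMap Prod.snd ++ f.2)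
  have hlen : (D₀.toList.flatMap Prod.snd ++ f.2).length ≤ N * M + M := by
    rw [List.length_append]
    refine Nat.add_le_add ((length_flatMap_le fun g hg =>
      (hD₀.fact_bounds hM (Finset.mem_toList.1 hg)).2).trans ?_) hfb.2
    rw [Finset.length_toList]
    exact Nat.mul_le_mul_right _ h2
  have hK : ∀ g : Fact, (g ∈ D₀ ∨ g = f) → g.1 < M → g.2.length ≤ M →
      Fact.map π g ∈ facts M K := by
    intro g hg hg1 hg2
    refine mem_facts.2 ⟨hg1, by simpa [Fact.map] using hg2, fun c hc => ?_⟩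
    obtain ⟨d, hdg, rfl⟩ := List.mem_map.1 hc
    refine (hπ2 d (List.mem_append.2 ?_)).trans_le (Nat.add_le_add_left hlen _)
    rcases hg with hg | rfl
    · exact .inl (List.mem_flatMap.2 ⟨g, Finset.mem_toList.2 hg, hdg⟩)
    · exact .inr hdg
  have hcov := hn (D₀.image (Fact.map π), Fact.map π f) (by
    rw [Finset.mem_toList, Finset.mem_product, Finset.mem_powerset, List.mem_toFinset]
    refine ⟨fun g hg => ?_, hK f (.inr rfl) hfb.1 hfb.2⟩
    obtain ⟨g, hg₀, rfl⟩ := Finset.mem_image.1 hg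
    have hg' := hD₀.fact_bounds hM hg₀
    exact List.mem_toFinset.2 (hK g (.inl hg₀) hg'.1 hg'.2)) (hD₀.image_map π) hf (h3.map hC hπ1)
  have hback := hcov.map (h.sound hPi hC n).consts (π := π.symm)
    (fun c hc => by rw [Equiv.symm_apply_eq, hπ1 c hc])
  rw [Fact.map_symm_map] at hback
  refine hback.mono (List.Subset.refl _) ?_
  rintro _ ⟨g, hg, rfl⟩
  obtain ⟨g, hg₀, rfl⟩ := Finset.mem_image.1 hg
  rw [Fact.map_symm_map]
  exact h1 hg₀

/-! ### Termination for bounded programs -/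

/-- The canonical database argument: the frozen body of `ρ` is an EDB from which `Pi` derives the
frozen head, so `S` covers that head, and the covering valuation unfreezes to a subsumption. -/
theorem exists_subsumes_of_unfolding {Pi : Prog} {S : List (Rule ℕ)} {C : ℕ}
    (hS : ∀ R ∈ S, Rule.ConstsLT C R)
    (hcov : ∀ D f, IsEDB Pi D → f.1 ∈ idb Pi → Derives Pi D f → Covers S D f)
    {ρ : Rule ℕ} (hρ : Unfolding Pi ρ) (hC : Rule.ConstsLT C ρ) : ∃ ρ' ∈ S, Subsumes ρ' ρ := by
  refine exists_subsumes_of_covers hS hC ?_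
  let D : Finset Fact := (ρ.2.map (Atom.ground fun v => v + C)).toFinset
  have hD : IsEDB Pi D := by
    intro f hf
    obtain ⟨b, hb, rfl⟩ := List.mem_map.1 (List.mem_toFinset.1 hf)
    obtain ⟨a, h1, h2, h3⟩ := hρ.arity b (List.mem_cons_of_mem _ hb)
    exact ⟨hρ.body b hb, a, h1, h2, by simpa [Atom.ground] using h3⟩
  refine (hcov D (Atom.ground (fun v => v + C) ρ.1) hD hρ.head ?_).mono (List.Subset.refl _) ?_
  · exact hρ.derives.derives fun b hb =>
      .base _ (List.mem_toFinset.2 (List.mem_map_of_mem hb))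
  · intro f hf
    obtain ⟨b, hb, rfl⟩ := List.mem_map.1 (List.mem_toFinset.1 hf)
    exact ⟨b, hb, rfl⟩

/-- When the adornments present cover all derivable facts, no new adornment is created. -/
theorem innerBody.adornments_subset {Pi : Prog} {C : ℕ} {R : Rule ℕ} {ρs : List (Rule ℕ)}
    {A B B' : AProg} (hPi : IsDatalog Pi) (hC : ∀ R ∈ Pi, Rule.ConstsLT C R) (hR : R ∈ Pi)
    (hcov : ∀ D f, IsEDB Pi D → f.1 ∈ idb Pi → Derives Pi D f → Covers (adornments A) D f)
    (hAB : A ⊆ B) (hB : Sound Pi C B) (hch : IsChoice Pi R B ρs)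
    (h : innerBody id hCont Pi R ρs B B') : adornments B' ⊆ adornments B := by
  obtain ⟨ρs', ⟨hv, -⟩, ⟨-, rfl⟩ | ⟨σ, R', hσ, rfl, ⟨-, rfl⟩ | ⟨hn, rfl⟩⟩⟩ := h
  · exact List.Subset.refl _
  · exact List.Subset.refl _
  refine List.Subset.trans (adornments_append_adornedRule hch)
    (List.cons_subset.2 ⟨?_, List.Subset.refl _⟩)
  by_contra hnew
  obtain ⟨h1, h2⟩ := hB.inlined hPi hC hR hch hv hσ
  obtain ⟨ρ', h3, h4⟩ := exists_subsumes_of_unfolding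
    (fun ρ hρ => hB.consts ρ (adornments_mono hAB hρ)) hcov h1 h2
  refine hn (.inl ⟨_, rfl, fun hrec => hnew ?_, ρ', mem_adornments.1 (adornments_mono hAB h3),
    h4.head_pred, h4⟩)
  -- A recursive predicate heads some rule, so its adornment would not be new. Hence the proviso of
  -- clause (1) holds for every new adornment.
  obtain ⟨q, ⟨R', h5, h6, -⟩, -⟩ := Relation.TransGen.head'_iff.1 hrec
  exact mem_adornments_of_head h5 h6

/-- The sizes, constants and EDB predicates of the rules of `A` are bounded in terms of `M`. -/
def Shape (M : ℕ) (A : AProg) : Prop :=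
  ∀ R ∈ A, R.2.length ≤ M + M ∧ ∀ a ∈ Rule.atoms R, a.2.length ≤ M ∧
    (∀ c : ℕ, (Sum.inr c : Term) ∈ a.2 → c < M) ∧ ∀ e, a.1 = Sum.inl e → e < M

theorem innerBody.shape {Pi : Prog} {M : ℕ} {R : Rule ℕ} {ρs : List (Rule ℕ)}
    {A A' : AProg} (hM : ∀ R ∈ Pi, Rule.BoundedBy M R) (hR : R ∈ Pi)
    (hA : Sound Pi M A) (hch : IsChoice Pi R A ρs)
    (h : innerBody id hCont Pi R ρs A A') (hs : Shape M A) : Shape M A' := by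
  obtain ⟨ρs', ⟨hv, -⟩, ⟨-, rfl⟩ | ⟨σ, R', hσ, rfl, ⟨-, rfl⟩ | ⟨-, rfl⟩⟩⟩ := h
  · exact hs
  · exact hs
  intro R' hR'
  rcases List.mem_append.1 hR' with hR' | hR'
  · exact hs R' hR'
  obtain rfl := List.mem_singleton.1 hR'
  have hb := hM R hR
  have key : ∀ b ∈ Rule.atoms R, (b.2.map (Term.subst σ)).length ≤ M ∧
      ∀ c : ℕ, (Sum.inr c : Term) ∈ b.2.map (Term.subst σ) → c < M := by
    intro b hb'
    refine ⟨by simpa using (hb.2 b hb').2.1, fun c hc => ?_⟩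
    obtain ⟨t, ht, h⟩ := List.mem_map.1 hc
    exact const_lt_of_isMGU hb.constsLT (hA.renamed hch hv).2.1 hσ
      (fun c hc => ((hb.2 b hb').2.2 t ht).2 c hc) h
  refine ⟨?_, fun a ha => ?_⟩
  · simp only [adornedRule, List.length_append, List.length_zipWith, List.length_map]
    exact Nat.add_le_add
      ((min_le_left _ _).trans ((List.length_filter_le _ _).trans hb.1))
      ((List.length_filter_le _ _).trans hb.1)
  · rcases List.mem_cons.1 ha with rfl | ha
    · obtain ⟨h1, h2⟩ := key R.1 List.mem_cons_self
      exact ⟨h1, h2, fun e he => by simp [adornedRule] at he⟩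
    · rcases List.mem_append.1 ha with ha | ha
      · obtain ⟨b, h3, ρ, -, rfl⟩ := exists_of_mem_zipWith ha
        obtain ⟨h1, h2⟩ := key b (List.mem_cons_of_mem _ (mem_idbAtoms.1 h3).1)
        exact ⟨h1, h2, fun e he => by simp at he⟩
      · obtain ⟨b, h3, rfl⟩ := List.mem_map.1 ha
        have h4 := List.mem_cons_of_mem R.1 (mem_edbAtoms.1 h3).1
        obtain ⟨h1, h2⟩ := key b h4
        refine ⟨h1, h2, fun e he => ?_⟩
        obtain rfl := Sum.inl_injective he
        exact (hb.2 b h4).1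

theorem innerBody.pairwise_not_variant {g : Rule ℕ → Rule ℕ} {Pi : Prog} {R : Rule ℕ}
    {ρs : List (Rule ℕ)} {A A' : AProg} (h : innerBody g hCont Pi R ρs A A')
    (hA : A.Pairwise fun R R' => ¬ ARule.Variant R' R) :
    A'.Pairwise fun R R' => ¬ ARule.Variant R' R := by
  obtain ⟨_, _, ⟨-, rfl⟩ | ⟨_, R', -, -, ⟨-, rfl⟩ | ⟨hn, rfl⟩⟩⟩ := h
  · exact hA
  · exact hA
  · refine List.pairwise_append.2 ⟨hA, List.pairwise_singleton _ _, fun S hS S' hS' hv => ?_⟩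
    obtain rfl := List.mem_singleton.1 hS'
    exact hn (.inr ⟨S, hS, hv⟩)

/-- `Rule.subst` acts on arguments only and leaves adornments alone, so the adornments of `R` and
`R'` agree literally. -/
theorem ARule.Variant.of_subst_eq {R R' : ARule} {f f' : Equiv.Perm ℕ}
    (h : Rule.subst (renameBy f) R = Rule.subst (renameBy f') R') : ARule.Variant R R' := by
  have h1 : R' = Rule.subst (renameBy (f.trans f'.symm)) R := by
    rw [← Rule.subst_renameBy_symm f' R', ← h, Rule.subst_subst]
    rfl
  refine ⟨f.trans f'.symm, ?_⟩
  rw [h1, Rule.atoms_subst, List.forall₂_map_right_iff, List.forall₂_same]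
  intro a _
  refine ⟨?_, rfl⟩
  obtain ⟨p | p, l⟩ := a
  · rfl
  · exact Rule.Variant.refl p

theorem exists_rename_bounded {P : Type} (R : Rule P) {M N : ℕ} (hN : R.2.length ≤ N)
    (hM : ∀ a ∈ Rule.atoms R, a.2.length ≤ M) : ∃ f : Equiv.Perm ℕ,
      ∀ v, Rule.HasVar (Rule.subst (renameBy f) R) v → v < (N + 1) * M := by
  obtain ⟨f, -, hf⟩ := exists_perm_lt 0
    ((Rule.atoms R).flatMap fun a => a.2.filterMap Sum.getLeft?)
  have hlen := length_flatMap_le (g := fun a : Atom P => a.2.filterMap Sum.getLeft?)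
    (l := Rule.atoms R) (M := M)
    fun a ha => (List.length_filterMap_le _ _).trans (hM a ha)
  refine ⟨f, fun v hv => ?_⟩
  obtain ⟨a, ha, hv⟩ := Rule.hasVar_renameBy.1 hv
  have h1 := hf _ (List.mem_flatMap.2 ⟨a, ha, List.mem_filterMap.2 ⟨_, hv, rfl⟩⟩)
  rw [Equiv.apply_symm_apply, zero_add] at h1
  refine h1.trans_le (hlen.trans (Nat.mul_le_mul_right _ ?_))
  rw [Rule.atoms, List.length_cons]
  omega

/-- An adorned program without repetitions up to renaming, with bounded rules and adornments
from a given list, has bounded length. -/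
theorem exists_length_bound (S : List (Rule ℕ)) (M : ℕ) : ∃ N, ∀ A : AProg,
    adornments A ⊆ S → Shape M A → A.Pairwise (fun R R' => ¬ ARule.Variant R' R) →
      A.length ≤ N := by
  -- A rule has a head and at most `M + M` body atoms, each with at most `M` arguments, so its
  -- variables can be renamed below `(M + M + 1) * M`.
  let T : List Term := (List.range ((M + M + 1) * M)).map Sum.inl ++ (List.range M).map Sum.inr
  let Q : List APred := S.map Sum.inr ++ (List.range M).map Sum.inl
  let At : List (Atom APred) := Q.flatMap fun p => (lists T M).map fun l => (p, l)
  let F : List ARule := At.flatMap fun a => (lists At (M + M)).map fun B => (a, B)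
  refine ⟨F.length, fun A hA hs hp => ?_⟩
  have hex : ∀ R : ARule, ∃ f : Equiv.Perm ℕ, R ∈ A → Rule.subst (renameBy f) R ∈ F := by
    intro R
    by_cases hR : R ∈ A
    · obtain ⟨h1, h2⟩ := hs R hR
      obtain ⟨f, hf⟩ := exists_rename_bounded R h1 fun a ha => (h2 a ha).1
      refine ⟨f, fun _ => ?_⟩
      have hAt : ∀ a ∈ Rule.atoms R, Atom.subst (renameBy f) a ∈ At := by
        intro a ha
        obtain ⟨h3, h4, h5⟩ := h2 a ha
        refine List.mem_flatMap.2 ⟨a.1, ?_, List.mem_map.2 ⟨a.2.map (Term.subst (renameBy f)),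
          mem_lists.2 ⟨by simpa using h3, fun t ht => ?_⟩, rfl⟩⟩
        · rcases hp : a.1 with e | ρ
          · exact List.mem_append_right _ (List.mem_map_of_mem (List.mem_range.2 (h5 e hp)))
          · exact List.mem_append_left _ (List.mem_map_of_mem
              (hA (mem_adornments.2 ⟨a, ⟨R, hR, ha⟩, hp⟩)))
        · rcases t with v | c
          · refine List.mem_append_left _ (List.mem_map_of_mem (List.mem_range.2 (hf v ?_)))
            exact ⟨Atom.subst (renameBy f) a, List.mem_map_of_mem ha, ht⟩
          · refine List.mem_append_right _ (List.mem_map_of_mem (List.mem_range.2 (h4 c ?_)))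
            obtain ⟨t, ht, h⟩ := List.mem_map.1 ht
            cases t with
            | inl w => simp [Term.subst, renameBy] at h
            | inr d => exact h ▸ ht
      refine List.mem_flatMap.2 ⟨_, hAt _ List.mem_cons_self, List.mem_map.2 ⟨_,
        mem_lists.2 ⟨by simpa using h1, fun b hb => ?_⟩, rfl⟩⟩
      obtain ⟨a, ha, rfl⟩ := List.mem_map.1 hb
      exact hAt a (List.mem_cons_of_mem _ ha)
    · exact ⟨Equiv.refl ℕ, fun h => absurd h hR⟩
  choose f hf using hex
  -- Two rules with the same normalized form would be variants, so normalization embeds `A` into the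
  -- finite list `F`.
  have hnd : (A.map fun R => Rule.subst (renameBy (f R)) R).Nodup := by
    rw [List.Nodup, List.pairwise_map]
    exact hp.imp fun h h' => h (ARule.Variant.of_subst_eq h'.symm)
  have := (List.subperm_of_subset hnd fun R hR => by
    obtain ⟨R, hR', rfl⟩ := List.mem_map.1 hR
    exact hf R hR').length_le
  simpa using this

theorem IsRun.terminates_of_bounded {Pi : Prog} {A : ℕ → AProg} (h : IsRun id hCont Pi A)
    (hPi : IsDatalog Pi) (hb : Bounded Pi) : Terminates A := by
  obtain ⟨M, hM⟩ := exists_boundedBy Pi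
  have hC : ∀ R ∈ Pi, Rule.ConstsLT M R := fun R hR => (hM R hR).constsLT
  obtain ⟨m, hm⟩ := h.exists_stage hPi hb
  by_contra hnt
  -- Passes only append, so a pass that does not lengthen the program leaves it unchanged.
  have hlen : ∀ n, n ≤ (A n).length := by
    intro n
    induction n with
    | zero => exact Nat.zero_le _
    | succ n ih =>
      have hpre := h.prefix (Nat.le_succ n)
      by_contra hlt
      have h1 := hpre.length_le
      exact hnt ⟨n, (hpre.eq_of_length (by simp only [Nat.succ_eq_add_one] at h1 ⊢; omega)).symm⟩
  have hinv : ∀ n, Sound Pi M (A n) ∧ Shape M (A n) ∧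
      (A n).Pairwise (fun R R' => ¬ ARule.Variant R' R) := fun n =>
    h.invariant (fun B => Sound Pi M B ∧ Shape M B ∧
      B.Pairwise (fun R R' => ¬ ARule.Variant R' R))
      (fun R hR ρs B B' hch hb hB => ⟨hB.1.innerBody hPi hC hR hch hb,
        hb.shape hM hR hB.1 hch hB.2.1, hb.pairwise_not_variant hB.2.2⟩)
      (m := 0) (by rw [h.1]; exact ⟨Sound.nil Pi M, fun _ h => by simp at h, .nil⟩)
      (Nat.zero_le n)
  have hsub : ∀ n, m ≤ n → adornments (A n) ⊆ adornments (A m) := fun n hn =>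
    (h.invariant (fun B => A m ⊆ B ∧ Sound Pi M B ∧ adornments B ⊆ adornments (A m))
      (fun R hR ρs B B' hch hb hB => ⟨List.Subset.trans hB.1 hb.prefix.subset,
        hB.2.1.innerBody hPi hC hR hch hb,
        List.Subset.trans (hb.adornments_subset hPi hC hR hm hB.1 hB.2.1 hch) hB.2.2⟩)
      ⟨List.Subset.refl _, (hinv m).1, List.Subset.refl _⟩ hn).2.2
  obtain ⟨N, hN⟩ := exists_length_bound (adornments (A m)) M
  have h1 := hN _ (hsub (max m (N + 1)) (le_max_left _ _)) (hinv _).2.1 (hinv _).2.2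
  have h2 := hlen (max m (N + 1))
  have h3 := le_max_right m (N + 1)
  omega

theorem IsRun.terminates_iff_bounded {Pi : Prog} {A : ℕ → AProg} (h : IsRun id hCont Pi A)
    (hPi : IsDatalog Pi) : Terminates A ↔ Bounded Pi :=
  ⟨h.bounded_of_terminates hPi, h.terminates_of_bounded hPi⟩

/-! ### Derivations as lists of instructions -/

/-- The substitution given by a list of terms. -/
def listSubst (s : List Term) (v : ℕ) : Term := s.getD v (Sum.inr 0)

/-- The assignment given by a list of constants. -/
def listVal (s : List ℕ) (v : ℕ) : ℕ := s.getD v 0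

open Classical in
/-- Add the head of an instance of a rule of `Pi` whose body is contained in `L`. -/
noncomputable def extend (Pi : Prog) (L : List (Atom ℕ)) (i : Rule ℕ × List Term) : List (Atom ℕ) :=
  if i.1 ∈ Pi ∧ ∀ b ∈ i.1.2, Atom.subst (listSubst i.2) b ∈ L then
    Atom.subst (listSubst i.2) i.1.1 :: L else L

theorem subset_extend {Pi : Prog} (L : List (Atom ℕ)) (i : Rule ℕ × List Term) :
    L ⊆ extend Pi L i := by
  unfold extend
  split_ifs
  · exact List.subset_cons_self _ _
  · exact List.Subset.refl _

theorem extend_mono {Pi : Prog} {L L' : List (Atom ℕ)} (h : L ⊆ L') (i : Rule ℕ × List Term) :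
    extend Pi L i ⊆ extend Pi L' i := by
  by_cases hi : i.1 ∈ Pi ∧ ∀ b ∈ i.1.2, Atom.subst (listSubst i.2) b ∈ L
  · unfold extend
    rw [if_pos hi, if_pos ⟨hi.1, fun b hb => h (hi.2 b hb)⟩]
    exact List.cons_subset_cons _ h
  · have : extend Pi L i = L := if_neg hi
    rw [this]
    exact List.Subset.trans h (subset_extend L' i)

theorem subset_foldl_extend {Pi : Prog} (l : List (Rule ℕ × List Term)) (L : List (Atom ℕ)) :
    L ⊆ l.foldl (extend Pi) L := by
  induction l generalizing L with
  | nil => exact List.Subset.refl _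
  | cons i l ih => exact List.Subset.trans (subset_extend L i) (ih _)

theorem foldl_extend_mono {Pi : Prog} (l : List (Rule ℕ × List Term)) {L L' : List (Atom ℕ)}
    (h : L ⊆ L') : l.foldl (extend Pi) L ⊆ l.foldl (extend Pi) L' := by
  induction l generalizing L L' with
  | nil => exact h
  | cons i l ih => exact ih (extend_mono h i)

theorem derivesAtom_of_mem_foldl {Pi : Prog} {B : List (Atom ℕ)} (l : List (Rule ℕ × List Term))
    {L : List (Atom ℕ)} (hL : ∀ a ∈ L, DerivesAtom Pi B a) {a : Atom ℕ}
    (ha : a ∈ l.foldl (extend Pi) L) : DerivesAtom Pi B a := by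
  induction l generalizing L with
  | nil => exact hL a ha
  | cons i l ih =>
    refine ih (fun a ha => ?_) ha
    unfold extend at ha
    split_ifs at ha with hi
    · rcases List.mem_cons.1 ha with rfl | ha
      · exact .step i.1 hi.1 _ fun b hb => hL _ (hi.2 b hb)
      · exact hL a ha
    · exact hL a ha

theorem Atom.subst_congr {σ τ : ℕ → Term} {a : Atom ℕ} (h : ∀ v, Atom.HasVar a v → σ v = τ v) :
    Atom.subst σ a = Atom.subst τ a := by
  refine Prod.ext rfl (List.map_congr_left fun t ht => ?_)
  cases t with
  | inl v => exact h v ht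
  | inr c => rfl

/-- A derivation tree is linearized by concatenating the lists for its subtrees. Inapplicable
instructions are skipped, so a larger starting list does no harm, and only the values of a
substitution on the variables of the rule need recording. -/
theorem DerivesAtom.exists_mem_foldl {Pi : Prog} {B : List (Atom ℕ)} {a : Atom ℕ}
    (h : DerivesAtom Pi B a) : ∃ l : List (Rule ℕ × List Term), a ∈ l.foldl (extend Pi) B := by
  induction h with
  | base a ha => exact ⟨[], ha⟩
  | step R hR σ _ ih =>
    have hl : ∀ bs : List (Atom ℕ), bs ⊆ R.2 → ∃ l : List (Rule ℕ × List Term),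
        ∀ b ∈ bs, Atom.subst σ b ∈ l.foldl (extend Pi) B := by
      intro bs hbs
      induction bs with
      | nil => exact ⟨[], by simp⟩
      | cons b bs ih' =>
        obtain ⟨l, hl⟩ := ih' (List.cons_subset.1 hbs).2
        obtain ⟨m, hm⟩ := ih b (List.cons_subset.1 hbs).1
        refine ⟨l ++ m, fun c hc => ?_⟩
        rw [List.foldl_append]
        rcases List.mem_cons.1 hc with rfl | hc
        · exact foldl_extend_mono m (subset_foldl_extend l B) hm
        · exact subset_foldl_extend m _ (hl c hc)
    obtain ⟨l, hl⟩ := hl R.2 (List.Subset.refl _)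
    obtain ⟨V, hV⟩ := Rule.exists_var_bound R
    have hs : ∀ b ∈ Rule.atoms R,
        Atom.subst (listSubst ((List.range V).map σ)) b = Atom.subst σ b := fun b hb =>
      Atom.subst_congr fun v hv => by simp [listSubst, hV v ⟨b, hb, hv⟩]
    refine ⟨l ++ [(R, (List.range V).map σ)], ?_⟩
    rw [List.foldl_append, List.foldl_cons, List.foldl_nil, extend, if_pos]
    · rw [hs _ List.mem_cons_self]
      exact List.mem_cons_self
    · exact ⟨hR, fun b hb => by
        rw [hs b (List.mem_cons_of_mem _ hb)]
        exact hl b hb⟩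

/-! ### Checking closedness on small databases -/

/-- `Covers`, with the values of the variables bounded by `K`. -/
def SmallCovers (S : List (Rule ℕ)) (M K : ℕ) (D : List Fact) (f : Fact) : Prop :=
  ∃ ρ ∈ S, ∃ s ∈ lists (List.range K) M, Atom.ground (listVal s) ρ.1 = f ∧
    ∀ b ∈ ρ.2, Atom.ground (listVal s) b ∈ D

/-- A number of constants that suffices to detect that a set of rules bounded by `M`
is not closed. -/
def constBound (M : ℕ) : ℕ := M + (M * M * M + M)

/-- `Closed`, for databases and assignments of bounded size. -/
def SmallClosed (Pi : Prog) (S : List (Rule ℕ)) (M : ℕ) : Prop :=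
  ∀ D ∈ lists (facts M (constBound M)) (M * M), ∀ R ∈ Pi,
    ∀ s ∈ lists (List.range (constBound M)) M,
      (∀ b ∈ R.2, (b.1 ∈ idb Pi → SmallCovers S M (constBound M) D (Atom.ground (listVal s) b)) ∧
        (b.1 ∉ idb Pi → Atom.ground (listVal s) b ∈ D)) →
      SmallCovers S M (constBound M) D (Atom.ground (listVal s) R.1)

theorem Rule.BoundedBy.var_lt {M : ℕ} {R : Rule ℕ} (h : Rule.BoundedBy M R) {a : Atom ℕ}
    (ha : a ∈ Rule.atoms R) {v : ℕ} (hv : Atom.HasVar a v) : v < M :=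
  ((h.2 a ha).2.2 _ hv).1 v rfl

theorem ground_listVal_map_range {M : ℕ} {R : Rule ℕ} (h : Rule.BoundedBy M R) (θ : ℕ → ℕ)
    {a : Atom ℕ} (ha : a ∈ Rule.atoms R) :
    Atom.ground (listVal ((List.range M).map θ)) a = Atom.ground θ a :=
  Atom.ground_congr fun v hv => by simp [listVal, h.var_lt ha hv]

theorem SmallCovers.covers {S : List (Rule ℕ)} {M K : ℕ} {D : List Fact} {f : Fact}
    (h : SmallCovers S M K D f) : Covers S {g | g ∈ D} f := by
  obtain ⟨ρ, hρ, s, -, h⟩ := h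
  exact ⟨ρ, hρ, _, h⟩

theorem Covers.smallCovers {S : List (Rule ℕ)} {M K : ℕ} {D : List Fact} {f : Fact}
    (hS : ∀ ρ ∈ S, Rule.BoundedBy M ρ) (hMK : M ≤ K) (hD : ∀ g ∈ D, ∀ c ∈ g.2, c < K)
    (hf : ∀ c ∈ f.2, c < K) (h : Covers S {g | g ∈ D} f) : SmallCovers S M K D f := by
  obtain ⟨ρ, hρ, θ, h1, h2⟩ := h
  -- A variable occurring in such an atom has its value among the constants of the ground atom;
  -- resetting large values to `0` thus affects only variables that do not occur.
  have hval : ∀ a ∈ Rule.atoms ρ, (∀ c ∈ (Atom.ground θ a).2, c < K) →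
      Atom.ground (fun v => if θ v < K then θ v else 0) a = Atom.ground θ a := by
    intro a _ hc
    exact Atom.ground_congr fun v hv => if_pos (hc _ (List.mem_map_of_mem hv))
  refine ⟨ρ, hρ, (List.range M).map fun v => if θ v < K then θ v else 0,
    mem_lists.2 ⟨by simp, fun x hx => ?_⟩, ?_, fun b hb => ?_⟩
  · obtain ⟨v, hv, rfl⟩ := List.mem_map.1 hx
    have := List.mem_range.1 hv
    refine List.mem_range.2 ?_
    split_ifs <;> omega
  · rw [ground_listVal_map_range (hS ρ hρ) _ List.mem_cons_self,
      hval _ List.mem_cons_self (h1 ▸ hf), h1]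
  · rw [ground_listVal_map_range (hS ρ hρ) _ (List.mem_cons_of_mem _ hb),
      hval _ (List.mem_cons_of_mem _ hb) (hD _ (h2 b hb))]
    exact h2 b hb

theorem listVal_lt {K : ℕ} (hK : 0 < K) {s : List ℕ} (hs : ∀ x ∈ s, x < K) (v : ℕ) :
    listVal s v < K := by
  unfold listVal
  by_cases hv : v < s.length
  · rw [List.getD_eq_getElem _ _ hv]
    exact hs _ (List.getElem_mem hv)
  · rwa [List.getD_eq_default _ _ (not_lt.1 hv)]

theorem le_constBound (M : ℕ) : M ≤ constBound M := Nat.le_add_right _ _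

theorem Closed.smallClosed {Pi : Prog} {S : List (Rule ℕ)} {M : ℕ}
    (hPi : ∀ R ∈ Pi, Rule.BoundedBy M R) (hS : ∀ ρ ∈ S, Rule.BoundedBy M ρ) (h : Closed Pi S) :
    SmallClosed Pi S M := by
  intro D hD R hR s hs hb
  have hD' : ∀ g ∈ D, ∀ c ∈ g.2, c < constBound M := fun g hg =>
    (mem_facts.1 ((mem_lists.1 hD).2 g hg)).2.2
  have hM := ((hPi R hR).2 R.1 List.mem_cons_self).1
  have hK := le_constBound M
  refine (h {g | g ∈ D} R hR (listVal s) fun b hb' =>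
    ⟨fun hi => ((hb b hb').1 hi).covers, (hb b hb').2⟩).smallCovers hS hK hD' ?_
  intro c hc
  obtain ⟨t, ht, rfl⟩ := List.mem_map.1 hc
  cases t with
  | inl v =>
    exact listVal_lt (by omega) (fun x hx => List.mem_range.1 ((mem_lists.1 hs).2 x hx)) v
  | inr c => exact ((hPi R hR).constsLT _ List.mem_cons_self c ht).trans_le hK

/-- Each body atom of `R` needs only the facts used by one rule of `S`, or itself if it is EDB.
Restrict the database to these facts, compress the constants, apply the small case, and rename back.
-/
theorem SmallClosed.closed {Pi : Prog} {S : List (Rule ℕ)} {M : ℕ}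
    (hPi : ∀ R ∈ Pi, Rule.BoundedBy M R) (hS : ∀ ρ ∈ S, Rule.BoundedBy M ρ)
    (h : SmallClosed Pi S M) : Closed Pi S := by
  intro D R hR θ hb
  have hbR := hPi R hR
  have hM : 0 < M := Nat.zero_lt_of_lt (hbR.2 R.1 List.mem_cons_self).1
  have hex : ∀ b : Atom ℕ, ∃ E : List Fact, b ∈ R.2 → E.length ≤ M ∧
      (∀ g ∈ E, g ∈ D ∧ g.1 < M ∧ g.2.length ≤ M) ∧
      (b.1 ∈ idb Pi → Covers S {g | g ∈ E} (Atom.ground θ b)) ∧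
      (b.1 ∉ idb Pi → Atom.ground θ b ∈ E) := by
    intro b
    by_cases hb' : b ∈ R.2
    swap
    · exact ⟨[], fun h => absurd h hb'⟩
    by_cases hi : b.1 ∈ idb Pi
    · obtain ⟨ρ, hρ, η, h1, h2⟩ := (hb b hb').1 hi
      refine ⟨ρ.2.map (Atom.ground η), fun _ => ⟨by simpa using (hS ρ hρ).1, fun g hg => ?_,
        fun _ => ⟨ρ, hρ, η, h1, fun c hc => List.mem_map_of_mem hc⟩, fun h => absurd hi h⟩⟩
      obtain ⟨c, hc, rfl⟩ := List.mem_map.1 hg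
      have := (hS ρ hρ).2 c (List.mem_cons_of_mem _ hc)
      exact ⟨h2 c hc, this.1, by simpa [Atom.ground] using this.2.1⟩
    · refine ⟨[Atom.ground θ b], fun _ => ⟨hM, fun g hg => ?_, fun h => absurd h hi,
        fun _ => List.mem_singleton_self _⟩⟩
      obtain rfl := List.mem_singleton.1 hg
      have := hbR.2 b (List.mem_cons_of_mem _ hb')
      exact ⟨(hb b hb').2 hi, this.1, by simpa [Atom.ground] using this.2.1⟩
  choose E hE using hex
  let D₀ := R.2.flatMap E
  have hD₀ : ∀ g ∈ D₀, g ∈ D ∧ g.1 < M ∧ g.2.length ≤ M := by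
    intro g hg
    obtain ⟨b, hb', hg⟩ := List.mem_flatMap.1 hg
    exact (hE b hb').2.1 g hg
  have hlen : D₀.length ≤ M * M :=
    (length_flatMap_le fun b hb' => (hE b hb').1).trans (Nat.mul_le_mul_right _ hbR.1)
  -- At most `M * M` facts with at most `M` arguments each, and `M` values of `θ`: this is the count
  -- in `constBound`.
  obtain ⟨π, hπ1, hπ2⟩ := exists_perm_lt M (D₀.flatMap Prod.snd ++ (List.range M).map θ)
  have hlen' : (D₀.flatMap Prod.snd ++ (List.range M).map θ).length ≤ M * M * M + M := by
    rw [List.length_append, List.length_map, List.length_range]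
    exact Nat.add_le_add_right ((length_flatMap_le fun g hg => (hD₀ g hg).2.2).trans
      (Nat.mul_le_mul_right _ hlen)) _
  have hπ3 : ∀ v ∈ D₀.flatMap Prod.snd ++ (List.range M).map θ, π v < constBound M :=
    fun v hv => (hπ2 v hv).trans_le (Nat.add_le_add_left hlen' _)
  have hval : ∀ a ∈ Rule.atoms R, Atom.ground (listVal ((List.range M).map fun v => π (θ v))) a =
      Fact.map π (Atom.ground θ a) := fun a ha => by
    rw [ground_listVal_map_range hbR _ ha, Fact.map_ground hπ1 (hbR.constsLT a ha)]
  have himg : (Fact.map π '' {g | g ∈ D₀}) = {g | g ∈ D₀.map (Fact.map π)} := by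
    ext g
    simp
  have hsC : ∀ ρ ∈ S, Rule.ConstsLT M ρ := fun ρ hρ => (hS ρ hρ).constsLT
  have hD₁ : ∀ g ∈ D₀.map (Fact.map π), g ∈ facts M (constBound M) := by
    intro g hg
    obtain ⟨g, hg', rfl⟩ := List.mem_map.1 hg
    refine mem_facts.2 ⟨(hD₀ g hg').2.1, by simpa [Fact.map] using (hD₀ g hg').2.2,
      fun c hc => ?_⟩
    obtain ⟨d, hd, rfl⟩ := List.mem_map.1 hc
    exact hπ3 d (List.mem_append_left _ (List.mem_flatMap.2 ⟨g, hg', hd⟩))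
  have hcov := (h (D₀.map (Fact.map π)) (mem_lists.2 ⟨by simpa using hlen, hD₁⟩) R hR
    ((List.range M).map fun v => π (θ v)) (mem_lists.2 ⟨by simp, fun x hx => by
      obtain ⟨v, hv, rfl⟩ := List.mem_map.1 hx
      exact List.mem_range.2 (hπ3 _ (List.mem_append_right _ (List.mem_map_of_mem hv)))⟩)
    (fun b hb' => by
      rw [hval b (List.mem_cons_of_mem _ hb')]
      refine ⟨fun hi => ?_, fun hi => List.mem_map_of_mem
        (List.mem_flatMap.2 ⟨b, hb', (hE b hb').2.2.2 hi⟩)⟩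
      have h1 : Covers S {g | g ∈ D₀} (Atom.ground θ b) :=
        ((hE b hb').2.2.1 hi).mono (List.Subset.refl _)
          fun g hg => List.mem_flatMap.2 ⟨b, hb', hg⟩
      refine Covers.smallCovers hS (le_constBound M)
        (fun g hg => (mem_facts.1 (hD₁ g hg)).2.2) (fun c hc => ?_) (himg ▸ h1.map hsC hπ1)
      obtain ⟨d, hd, rfl⟩ := List.mem_map.1 hc
      obtain ⟨t, ht, rfl⟩ := List.mem_map.1 hd
      cases t with
      | inl v =>
        exact hπ3 _ (List.mem_append_right _ (List.mem_map_of_mem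
          (List.mem_range.2 (hbR.var_lt (List.mem_cons_of_mem _ hb') ht))))
      | inr c =>
        have hc := hbR.constsLT b (List.mem_cons_of_mem _ hb') c ht
        rw [Term.ground, hπ1 c hc]
        exact hc.trans_le (le_constBound M))).covers
  rw [hval _ List.mem_cons_self, ← himg] at hcov
  have hback := hcov.map hsC (π := π.symm) (fun c hc => by rw [Equiv.symm_apply_eq, hπ1 c hc])
  rw [Fact.map_symm_map] at hback
  refine hback.mono (List.Subset.refl _) ?_
  rintro _ ⟨_, ⟨g, hg, rfl⟩, rfl⟩
  rw [Fact.map_symm_map]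
  exact (hD₀ g hg).1

/-! ### Certificates of boundedness -/

/-- Certificates: rules with derivations, and a numerical bound. -/
abbrev Certificate := List (Rule ℕ × List (Rule ℕ × List Term)) × ℕ

/-- `R` is a safe rule, in a form with bounded quantifiers. -/
def SafeCheck (R : Rule ℕ) : Prop := ∀ t ∈ R.1.2, t.isRight = true ∨ ∃ b ∈ R.2, t ∈ b.2

/-- `IsDatalog`, in a form with bounded quantifiers. -/
def DatalogCheck (Pi : Prog) : Prop :=
  (∀ R ∈ Pi, ∀ a ∈ Rule.atoms R, ∀ R' ∈ Pi, ∀ a' ∈ Rule.atoms R',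
    a.1 ≠ a'.1 ∨ a.2.length = a'.2.length) ∧
  (∀ R ∈ Pi, SafeCheck R) ∧ ∀ R ∈ Pi, R.1.1 ∈ idb Pi

/-- `Unfolding`, with a given derivation. -/
def UnfoldingCheck (Pi : Prog) (x : Rule ℕ × List (Rule ℕ × List Term)) : Prop :=
  x.1.1.1 ∈ idb Pi ∧ (∀ b ∈ x.1.2, b.1 ∉ idb Pi) ∧
  (∀ a ∈ Rule.atoms x.1, ∃ R ∈ Pi, ∃ a' ∈ Rule.atoms R, a'.1 = a.1 ∧ a'.2.length = a.2.length) ∧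
  SafeCheck x.1 ∧ x.1.1 ∈ x.2.foldl (extend Pi) x.1.2

/-- The certificate `c` shows that `Pi` is a bounded datalog program. -/
def Certifies (Pi : Prog) (c : Certificate) : Prop :=
  DatalogCheck Pi ∧ (∀ R ∈ Pi, Rule.BoundedBy c.2 R) ∧
  (∀ x ∈ c.1, Rule.BoundedBy c.2 x.1 ∧ UnfoldingCheck Pi x) ∧
  SmallClosed Pi (c.1.map Prod.fst) c.2

theorem safeCheck_iff {R : Rule ℕ} : SafeCheck R ↔ Rule.Safe R := by
  constructor
  · intro h v hv
    exact (h _ hv).resolve_left (by simp)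
  · rintro h (v | c) ht
    · exact .inr (h v ht)
    · exact .inl rfl

theorem datalogCheck_iff {Pi : Prog} : DatalogCheck Pi ↔ IsDatalog Pi := by
  classical
  refine and_congr ⟨fun h => ?_, fun ⟨ar, har⟩ R hR a ha R' hR' a' ha' => ?_⟩
    (and_congr (forall₂_congr fun _ _ => safeCheck_iff) Iff.rfl)
  -- The arity is read off one chosen occurrence of the predicate; the pairwise check makes the
  -- choice immaterial.
  · refine ⟨fun p => if hp : ∃ a, Program.HasAtom Pi a ∧ a.1 = p then hp.choose.2.length else 0,
      fun a ha => ?_⟩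
    have hp : ∃ a', Program.HasAtom Pi a' ∧ a'.1 = a.1 := ⟨a, ha, rfl⟩
    refine Eq.trans ?_ (dif_pos hp).symm
    obtain ⟨R, hR, ha⟩ := ha
    obtain ⟨⟨R', hR', h1⟩, h2⟩ := hp.choose_spec
    exact (h R hR a ha R' hR' _ h1).resolve_left fun h => h h2.symm
  · by_cases h : a.1 = a'.1
    · right
      rw [har a ⟨R, hR, ha⟩, har a' ⟨R', hR', ha'⟩, h]
    · exact .inl h

theorem unfolding_iff_exists_check {Pi : Prog} {ρ : Rule ℕ} :
    Unfolding Pi ρ ↔ ∃ l, UnfoldingCheck Pi (ρ, l) := by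
  constructor
  · intro h
    obtain ⟨l, hl⟩ := h.derives.exists_mem_foldl
    refine ⟨l, h.head, h.body, fun a ha => ?_, safeCheck_iff.2 h.safe, hl⟩
    obtain ⟨a', ⟨R, hR, ha'⟩, h⟩ := h.arity a ha
    exact ⟨R, hR, a', ha', h⟩
  · rintro ⟨l, h1, h2, h3, h4, h5⟩
    refine ⟨h1, h2, fun a ha => ?_, safeCheck_iff.1 h4,
      derivesAtom_of_mem_foldl l (fun a ha => .base a ha) h5⟩
    obtain ⟨R, hR, a', ha', h⟩ := h3 a ha
    exact ⟨a', ⟨R, hR, ha'⟩, h⟩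

/-- A certificate exhibits a closed set of unfoldings. Conversely, some run exists, boundedness
makes it stop, and its final adornments form such a set. -/
theorem exists_certifies_iff {Pi : Prog} :
    (∃ c, Certifies Pi c) ↔ IsDatalog Pi ∧ Bounded Pi := by
  constructor
  · rintro ⟨c, h1, h2, h3, h4⟩
    have hPi := datalogCheck_iff.1 h1
    have hS : ∀ ρ ∈ c.1.map Prod.fst, Rule.BoundedBy c.2 ρ ∧ Unfolding Pi ρ := by
      intro ρ hρ
      obtain ⟨x, hx, rfl⟩ := List.mem_map.1 hρ
      exact ⟨(h3 x hx).1, unfolding_iff_exists_check.2 ⟨x.2, (h3 x hx).2⟩⟩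
    exact ⟨hPi, bounded_of_closed hPi (fun ρ hρ => (hS ρ hρ).2)
      (h4.closed h2 fun ρ hρ => (hS ρ hρ).1)⟩
  · rintro ⟨hPi, hb⟩
    obtain ⟨A, hA⟩ := exists_isRun id hCont Pi
    obtain ⟨n, hn⟩ := hA.terminates_of_bounded hPi hb
    obtain ⟨C, hC⟩ := exists_const_bound Pi
    have hS := (hA.sound hPi hC n).unfolding
    have hex : ∀ ρ, ∃ l, ρ ∈ adornments (A n) → UnfoldingCheck Pi (ρ, l) := by
      intro ρ
      by_cases hρ : ρ ∈ adornments (A n)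
      · obtain ⟨l, hl⟩ := unfolding_iff_exists_check.1 (hS ρ hρ)
        exact ⟨l, fun _ => hl⟩
      · exact ⟨[], fun h => absurd h hρ⟩
    choose l hl using hex
    obtain ⟨M, hM⟩ := exists_boundedBy (Pi ++ adornments (A n))
    have hM1 : ∀ R ∈ Pi, Rule.BoundedBy M R := fun R hR => hM R (List.mem_append_left _ hR)
    have hM2 : ∀ R ∈ adornments (A n), Rule.BoundedBy M R := fun R hR =>
      hM R (List.mem_append_right _ hR)
    refine ⟨((adornments (A n)).map fun ρ => (ρ, l ρ), M), datalogCheck_iff.2 hPi, hM1,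
      fun x hx => ?_, ?_⟩
    · obtain ⟨ρ, hρ, rfl⟩ := List.mem_map.1 hx
      exact ⟨hM2 ρ hρ, hl ρ hρ⟩
    · have : ((adornments (A n)).map fun ρ => (ρ, l ρ)).map Prod.fst = adornments (A n) := by
        simp [Function.comp_def]
      rw [this]
      exact (hA.closed_of_eq hPi hn).smallClosed hM1 hM2

/-! ### Primitive recursiveness of the check -/

section Primrec

variable {α β γ : Type*} [Primcodable α] [Primcodable β] [Primcodable γ]

/-- Unbounded search through the codes of the witnesses. -/
theorem rePred_exists {p : α → β → Prop} (hp : PrimrecPred fun x : α × β => p x.1 x.2) :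
    REPred fun a => ∃ b, p a b := by
  classical
  let f : α → ℕ → Option Unit := fun a n =>
    (Encodable.decode (α := β) n).bind fun b => if p a b then some () else none
  have hf : Computable₂ f := by
    refine Primrec.to_comp (Primrec.option_bind (Primrec.decode.comp Primrec.snd) ?_)
    refine Primrec.ite (hp.comp ((Primrec.fst.comp Primrec.fst).pair Primrec.snd))
      (Primrec.const _) (Primrec.const _)
  refine (Partrec.dom_re (Partrec.rfindOpt hf)).of_eq fun a => ?_
  rw [Nat.rfindOpt_dom]
  constructor
  · rintro ⟨n, u, h⟩
    obtain ⟨b, -, h⟩ := Option.bind_eq_some_iff.1 h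
    refine ⟨b, ?_⟩
    by_contra hb
    simp [hb] at h
  · rintro ⟨b, hb⟩
    exact ⟨Encodable.encode b, (), by simp [f, hb]⟩

theorem primrecPred_forall_mem {p : α → β → Prop} {f : α → List β} (hf : Primrec f)
    (hp : PrimrecPred fun x : α × β => p x.1 x.2) : PrimrecPred fun a => ∀ b ∈ f a, p a b := by
  have h : PrimrecRel fun (b : β) (a : α) => p a b := hp.comp (Primrec.snd.pair Primrec.fst)
  exact h.forall_mem_list.comp hf Primrec.id

theorem primrecPred_exists_mem {p : α → β → Prop} {f : α → List β} (hf : Primrec f)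
    (hp : PrimrecPred fun x : α × β => p x.1 x.2) : PrimrecPred fun a => ∃ b ∈ f a, p a b := by
  have h : PrimrecRel fun (b : β) (a : α) => p a b := hp.comp (Primrec.snd.pair Primrec.fst)
  exact h.exists_mem_list.comp hf Primrec.id

theorem primrecPred_mem {f : α → β} {g : α → List β} (hf : Primrec f) (hg : Primrec g) :
    PrimrecPred fun a => f a ∈ g a :=
  (primrecPred_exists_mem (p := fun a b => b = f a) hg
    (Primrec.eq.comp Primrec.snd (hf.comp Primrec.fst))).of_eq
    fun a => by simp

theorem primrecPred_imp {p q : α → Prop} (hp : PrimrecPred p) (hq : PrimrecPred q) :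
    PrimrecPred fun a => p a → q a :=
  (hp.not.or hq).of_eq fun _ => imp_iff_not_or.symm

theorem primrec_lists {f : α → List β} {g : α → ℕ} (hf : Primrec f) (hg : Primrec g) :
    Primrec fun a => lists (f a) (g a) := by
  have h : Primrec₂ fun (a : α) (x : ℕ × List (List β)) =>
      ([] : List β) :: (f a).flatMap fun b => x.2.map (List.cons b) :=
    Primrec.list_cons.comp (Primrec.const _) (Primrec.list_flatMap (hf.comp Primrec.fst)
      (Primrec.list_map (Primrec.snd.comp (Primrec.snd.comp Primrec.fst))
        (Primrec.list_cons.comp (Primrec.snd.comp Primrec.fst) Primrec.snd)))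
  refine (Primrec.nat_rec' hg (Primrec.const [[]]) h).of_eq fun a => ?_
  induction g a with
  | zero => rfl
  | succ n ih => simp only [ih, lists]

theorem primrec_facts {f g : α → ℕ} (hf : Primrec f) (hg : Primrec g) :
    Primrec fun a => facts (f a) (g a) :=
  Primrec.list_flatMap (Primrec.list_range.comp hf) (Primrec.list_map
    ((primrec_lists (Primrec.list_range.comp hg) hf).comp Primrec.fst)
    ((Primrec.snd.comp Primrec.fst).pair Primrec.snd))

theorem primrec_atoms {f : α → Rule ℕ} (hf : Primrec f) : Primrec fun a => Rule.atoms (f a) :=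
  Primrec.list_cons.comp (Primrec.fst.comp hf) (Primrec.snd.comp hf)

theorem primrecPred_mem_idb {f : α → ℕ} {Pi : α → Prog} (hf : Primrec f) (hPi : Primrec Pi) :
    PrimrecPred fun a => f a ∈ idb (Pi a) := by
  have h : PrimrecPred fun a => ∃ R ∈ Pi a, R.2 ≠ [] ∧ R.1.1 = f a :=
    primrecPred_exists_mem hPi ((Primrec.eq.comp (Primrec.snd.comp Primrec.snd)
      (Primrec.const [])).not.and (Primrec.eq.comp
        (Primrec.fst.comp (Primrec.fst.comp Primrec.snd)) (hf.comp Primrec.fst)))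
  refine h.of_eq fun a => ?_
  simp only [idb, List.mem_map, List.mem_filter, decide_eq_true_eq, and_assoc]

theorem primrec_subst {f : α → Atom ℕ} {s : α → List Term} (hf : Primrec f) (hs : Primrec s) :
    Primrec fun a => Atom.subst (listSubst (s a)) (f a) := by
  refine (Primrec.fst.comp hf).pair (Primrec.list_map (Primrec.snd.comp hf) ?_)
  have h : Primrec₂ fun (a : α) (t : Term) => Sum.casesOn (motive := fun _ => Term) t
      (fun v => listSubst (s a) v) (fun c => Sum.inr c) :=
    Primrec.sumCasesOn Primrec.snd
      ((Primrec.list_getD _).comp (hs.comp (Primrec.fst.comp Primrec.fst)) Primrec.snd)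
      (Primrec.sumInr.comp Primrec.snd)
  exact h.of_eq fun a t => by cases t <;> rfl

theorem primrec_ground {f : α → Atom ℕ} {s : α → List ℕ} (hf : Primrec f) (hs : Primrec s) :
    Primrec fun a => Atom.ground (listVal (s a)) (f a) := by
  refine (Primrec.fst.comp hf).pair (Primrec.list_map (Primrec.snd.comp hf) ?_)
  have h : Primrec₂ fun (a : α) (t : Term) => Sum.casesOn (motive := fun _ => ℕ) t
      (fun v => listVal (s a) v) (fun c => c) :=
    Primrec.sumCasesOn Primrec.snd
      ((Primrec.list_getD _).comp (hs.comp (Primrec.fst.comp Primrec.fst)) Primrec.snd)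
      Primrec.snd
  exact h.of_eq fun a t => by cases t <;> rfl

theorem primrec_foldl_extend {Pi : α → Prog} {L : α → List (Atom ℕ)}
    {l : α → List (Rule ℕ × List Term)} (hPi : Primrec Pi) (hL : Primrec L) (hl : Primrec l) :
    Primrec fun a => (l a).foldl (extend (Pi a)) (L a) := by
  classical
  refine Primrec.list_foldl hl hL (h := fun a x => extend (Pi a) x.1 x.2) ?_
  have hi : Primrec fun x : α × (List (Atom ℕ) × (Rule ℕ × List Term)) => x.2.2.1 :=
    Primrec.fst.comp (Primrec.snd.comp Primrec.snd)
  have hs : Primrec fun x : α × (List (Atom ℕ) × (Rule ℕ × List Term)) => x.2.2.2 :=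
    Primrec.snd.comp (Primrec.snd.comp Primrec.snd)
  have hx : Primrec fun x : α × (List (Atom ℕ) × (Rule ℕ × List Term)) => x.2.1 :=
    Primrec.fst.comp Primrec.snd
  refine (Primrec.ite ((primrecPred_mem hi (hPi.comp Primrec.fst)).and
    (primrecPred_forall_mem (p := fun x b => Atom.subst (listSubst x.2.2.2) b ∈ x.2.1)
      (Primrec.snd.comp hi) (primrecPred_mem
        (primrec_subst Primrec.snd (hs.comp Primrec.fst)) (hx.comp Primrec.fst))))
    (Primrec.list_cons.comp (primrec_subst (Primrec.fst.comp hi) hs) hx) hx).of_eq fun x => ?_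
  unfold extend
  -- The two conditionals can differ only in their decidability instances.
  congr

theorem primrecPred_boundedBy {M : α → ℕ} {R : α → Rule ℕ} (hM : Primrec M) (hR : Primrec R) :
    PrimrecPred fun a => Rule.BoundedBy (M a) (R a) := by
  have hterm : PrimrecPred fun x : (α × Atom ℕ) × Term =>
      (∀ v, x.2 = Sum.inl v → v < M x.1.1) ∧ ∀ c, x.2 = Sum.inr c → c < M x.1.1 := by
    have hv : Primrec fun x : (α × Atom ℕ) × Term =>
        Sum.casesOn (motive := fun _ => ℕ) x.2 (fun v => v) (fun c => c) :=
      Primrec.sumCasesOn Primrec.snd Primrec.snd Primrec.snd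
    refine (Primrec.nat_lt.comp hv (hM.comp (Primrec.fst.comp Primrec.fst))).of_eq ?_
    rintro ⟨x, v | c⟩ <;> simp
  refine (Primrec.nat_le.comp (Primrec.list_length.comp (Primrec.snd.comp hR)) hM).and
    (primrecPred_forall_mem (primrec_atoms hR) ?_)
  have hM' : Primrec fun x : α × Atom ℕ => M x.1 := hM.comp Primrec.fst
  have ha : Primrec fun x : α × Atom ℕ => x.2.2 := Primrec.snd.comp Primrec.snd
  exact (Primrec.nat_lt.comp (Primrec.fst.comp Primrec.snd) hM').and
    ((Primrec.nat_le.comp (Primrec.list_length.comp ha) hM').and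
      (primrecPred_forall_mem ha hterm))

theorem primrecPred_smallCovers {S : α → List (Rule ℕ)} {M K : α → ℕ} {D : α → List Fact}
    {f : α → Fact} (hS : Primrec S) (hM : Primrec M) (hK : Primrec K) (hD : Primrec D)
    (hf : Primrec f) : PrimrecPred fun a => SmallCovers (S a) (M a) (K a) (D a) (f a) := by
  refine primrecPred_exists_mem hS (primrecPred_exists_mem
    (primrec_lists (Primrec.list_range.comp (hK.comp Primrec.fst)) (hM.comp Primrec.fst)) ?_)
  have hρ : Primrec fun x : (α × Rule ℕ) × List ℕ => x.1.2 := Primrec.snd.comp Primrec.fst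
  have ha : Primrec fun x : (α × Rule ℕ) × List ℕ => x.1.1 := Primrec.fst.comp Primrec.fst
  refine (Primrec.eq.comp (primrec_ground (Primrec.fst.comp hρ) Primrec.snd) (hf.comp ha)).and
    (primrecPred_forall_mem (Primrec.snd.comp hρ) (primrecPred_mem
      (primrec_ground Primrec.snd (Primrec.snd.comp Primrec.fst))
      ((hD.comp ha).comp Primrec.fst)))

theorem primrec_constBound {M : α → ℕ} (hM : Primrec M) : Primrec fun a => constBound (M a) :=
  Primrec.nat_add.comp hM (Primrec.nat_add.comp
    (Primrec.nat_mul.comp (Primrec.nat_mul.comp hM hM) hM) hM)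

theorem primrecPred_smallClosed {Pi : α → Prog} {S : α → List (Rule ℕ)} {M : α → ℕ}
    (hPi : Primrec Pi) (hS : Primrec S) (hM : Primrec M) :
    PrimrecPred fun a => SmallClosed (Pi a) (S a) (M a) := by
  have hK := primrec_constBound hM
  refine primrecPred_forall_mem (primrec_lists (primrec_facts hM hK) (Primrec.nat_mul.comp hM hM))
    (primrecPred_forall_mem (hPi.comp Primrec.fst) (primrecPred_forall_mem
      (primrec_lists (Primrec.list_range.comp (hK.comp (Primrec.fst.comp Primrec.fst)))
        (hM.comp (Primrec.fst.comp Primrec.fst))) ?_))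
  have ha : Primrec fun x : ((α × List Fact) × Rule ℕ) × List ℕ => x.1.1.1 :=
    Primrec.fst.comp (Primrec.fst.comp Primrec.fst)
  have hD : Primrec fun x : ((α × List Fact) × Rule ℕ) × List ℕ => x.1.1.2 :=
    Primrec.snd.comp (Primrec.fst.comp Primrec.fst)
  have hR : Primrec fun x : ((α × List Fact) × Rule ℕ) × List ℕ => x.1.2 :=
    Primrec.snd.comp Primrec.fst
  refine primrecPred_imp (primrecPred_forall_mem (Primrec.snd.comp hR) ?_)
    (primrecPred_smallCovers (hS.comp ha) (hM.comp ha) (hK.comp ha) hD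
      (primrec_ground (Primrec.fst.comp hR) Primrec.snd))
  have ha' := ha.comp (Primrec.fst (β := Atom ℕ))
  have hD' := hD.comp (Primrec.fst (β := Atom ℕ))
  have hi : PrimrecPred fun y : (((α × List Fact) × Rule ℕ) × List ℕ) × Atom ℕ =>
      y.2.1 ∈ idb (Pi y.1.1.1.1) :=
    primrecPred_mem_idb (Primrec.fst.comp Primrec.snd) (hPi.comp ha')
  have hg : Primrec fun y : (((α × List Fact) × Rule ℕ) × List ℕ) × Atom ℕ =>
      Atom.ground (listVal y.1.2) y.2 :=
    primrec_ground Primrec.snd (Primrec.snd.comp Primrec.fst)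
  exact (primrecPred_imp hi (primrecPred_smallCovers (hS.comp ha') (hM.comp ha') (hK.comp ha')
    hD' hg)).and (primrecPred_imp hi.not (primrecPred_mem hg hD'))

theorem primrecPred_safeCheck {R : α → Rule ℕ} (hR : Primrec R) :
    PrimrecPred fun a => SafeCheck (R a) := by
  have hright : Primrec fun x : α × Term => x.2.isRight := by
    have h : Primrec fun x : α × Term =>
        Sum.casesOn (motive := fun _ => Bool) x.2 (fun _ => false) (fun _ => true) :=
      Primrec.sumCasesOn Primrec.snd (Primrec.const _).to₂ (Primrec.const _).to₂
    exact h.of_eq fun x => by obtain ⟨_, v | c⟩ := x <;> rfl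
  refine primrecPred_forall_mem (Primrec.snd.comp (Primrec.fst.comp hR))
    ((Primrec.eq.comp hright (Primrec.const true)).or (primrecPred_exists_mem
      (Primrec.snd.comp (hR.comp Primrec.fst)) (primrecPred_mem
        (Primrec.snd.comp Primrec.fst) (Primrec.snd.comp Primrec.snd))))

theorem primrecPred_datalogCheck : PrimrecPred DatalogCheck := by
  refine PrimrecPred.and ?_ ((primrecPred_forall_mem Primrec.id
    (primrecPred_safeCheck Primrec.snd)).and (primrecPred_forall_mem Primrec.id
      (primrecPred_mem_idb (Primrec.fst.comp (Primrec.fst.comp Primrec.snd)) Primrec.fst)))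
  refine primrecPred_forall_mem Primrec.id (primrecPred_forall_mem (primrec_atoms Primrec.snd)
    (primrecPred_forall_mem (Primrec.fst.comp Primrec.fst)
      (primrecPred_forall_mem (primrec_atoms Primrec.snd) ?_)))
  have ha : Primrec fun x : ((((Prog × Rule ℕ) × Atom ℕ) × Rule ℕ) × Atom ℕ) => x.1.1.2 :=
    Primrec.snd.comp (Primrec.fst.comp Primrec.fst)
  exact (Primrec.eq.comp (Primrec.fst.comp ha) (Primrec.fst.comp Primrec.snd)).not.or
    (Primrec.eq.comp (Primrec.list_length.comp (Primrec.snd.comp ha))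
      (Primrec.list_length.comp (Primrec.snd.comp Primrec.snd)))

theorem primrecPred_unfoldingCheck {Pi : α → Prog}
    {x : α → Rule ℕ × List (Rule ℕ × List Term)} (hPi : Primrec Pi) (hx : Primrec x) :
    PrimrecPred fun a => UnfoldingCheck (Pi a) (x a) := by
  have hρ := Primrec.fst.comp hx
  refine (primrecPred_mem_idb (Primrec.fst.comp (Primrec.fst.comp hρ)) hPi).and
    ((primrecPred_forall_mem (Primrec.snd.comp hρ) (primrecPred_mem_idb
      (Primrec.fst.comp Primrec.snd) (hPi.comp Primrec.fst)).not).and (PrimrecPred.and ?_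
        ((primrecPred_safeCheck hρ).and (primrecPred_mem (Primrec.fst.comp hρ)
          (primrec_foldl_extend hPi (Primrec.snd.comp hρ) (Primrec.snd.comp hx))))))
  refine primrecPred_forall_mem (primrec_atoms hρ) (primrecPred_exists_mem
    (hPi.comp Primrec.fst) (primrecPred_exists_mem (primrec_atoms Primrec.snd) ?_))
  have ha : Primrec fun x : ((α × Atom ℕ) × Rule ℕ) × Atom ℕ => x.1.1.2 :=
    Primrec.snd.comp (Primrec.fst.comp Primrec.fst)
  exact (Primrec.eq.comp (Primrec.fst.comp Primrec.snd) (Primrec.fst.comp ha)).and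
    (Primrec.eq.comp (Primrec.list_length.comp (Primrec.snd.comp Primrec.snd))
      (Primrec.list_length.comp (Primrec.snd.comp ha)))

end Primrec

theorem primrecPred_certifies :
    PrimrecPred fun x : Prog × Certificate => Certifies x.1 x.2 := by
  have hPi : Primrec fun x : Prog × Certificate => x.1 := Primrec.fst
  have hS : Primrec fun x : Prog × Certificate => x.2.1 := Primrec.fst.comp Primrec.snd
  have hM : Primrec fun x : Prog × Certificate => x.2.2 := Primrec.snd.comp Primrec.snd
  refine (primrecPred_datalogCheck.comp hPi).and ((primrecPred_forall_mem hPi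
    (primrecPred_boundedBy (hM.comp Primrec.fst) Primrec.snd)).and
      ((primrecPred_forall_mem hS ((primrecPred_boundedBy (hM.comp Primrec.fst)
        (Primrec.fst.comp Primrec.snd)).and (primrecPred_unfoldingCheck (hPi.comp Primrec.fst)
          Primrec.snd))).and (primrecPred_smallClosed hPi
            (Primrec.list_map hS (Primrec.fst.comp Primrec.snd)) hM)))

end Datalog

theorem mainTheorem4 :
    (∀ Pi : Datalog.Prog, Datalog.IsDatalog Pi →
      (∃ A, Datalog.IsRun id Datalog.hCont Pi A) ∧
      ∀ A, Datalog.IsRun id Datalog.hCont Pi A →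
        (Datalog.Terminates A ↔ Datalog.Bounded Pi)) ∧
    REPred (fun Pi : Datalog.Prog => Datalog.IsDatalog Pi ∧ Datalog.Bounded Pi) :=
  ⟨fun Pi hPi => ⟨Datalog.exists_isRun id Datalog.hCont Pi,
    fun _ hA => hA.terminates_iff_bounded hPi⟩,
    (Datalog.rePred_exists Datalog.primrecPred_certifies).of_eq
      fun _ => Datalog.exists_certifies_iff⟩
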